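/- \textbf{Conventions.} A \emph{piecewise C*-algebra} is a set $A$ with a reflexive symmetric relation $\odot$ (commeasurability), elements $0,1$, an involution $*\colon A\to A$, a scalar multiplication $\mathbb C\times A\to A$, a function $\|-\|\colon A\to\mathbb R$, and partial operations $+,\cdot\colon\odot\to A$, such that every set of pairwise commeasurable elements is contained in a set of pairwise commeasurable elements that is a commutative (unital) C*-algebra under these operations. Put $\mathrm{Proj}(A)=\{p: p^*=p=p^2\}$ and $U(A)=\{u: u\odot u^*,\ uu^*=1\}$. A \emph{piecewise AW*-algebra} is a piecewise C*-algebra $A$ with a function $\mathrm{RP}\colon A\to \mathrm{Proj}(A)$ and an operation $\bigvee$ assigning to each pairwise commeasurable set of projections a projection, such that to every pairwise commeasurable set $S\subseteq A$ one can assign a pairwise commeasurable set $T(S)\supseteq S$ that is a commutative AW*-algebra under the operations of $A$ (right supporting projections being given by $\mathrm{RP}$ and suprema of projections by $\bigvee$), coherently: if $S\subseteq S'$ then $T(S)$ is an AW*-subalgebra of $T(S')$. (An AW*-algebra is a C*-algebra in which the right annihilator of any subset is generated as a right ideal by a projection.) A \emph{morphism} of piecewise AW*-algebras is a function preserving $\odot$,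 $1$, $+$ and $\cdot$ on commeasurable pairs, scalar multiplication, $*$, and $\bigvee$ of pairwise commeasurable sets of projections. A \emph{complete orthomodular lattice} is a complete lattice $P$ with an order-reversing involution $p\mapsto p^\perp$ such that $p\vee p^\perp=1$, $p\wedge p^\perp=0$, and $p\vee(p^\perp\wedge q)=q$ whenever $p\le q$; morphisms preserve $\perp$ and arbitrary suprema. Elements $p,q\in P$ are commeasurable if there are pairwise orthogonal $p',q',r$ with $p=p'\vee r$, $q=q'\vee r$. For a complete orthomodular lattice $P$, the piecewise algebra $F(P)$ is the colimit (disjoint union modulo the equivalence relation generated by inclusions) of the algebras $C(\mathrm{Stone}(C),\mathbb C)$, where $C$ ranges over the pairwise commeasurable subsets of $P$ closed under $\perp$ and arbitrary suprema (these are complete Boolean algebras), and $\mathrm{Stone}(C)$ is the Stone space of $C$; two classes are commeasurable if they have representatives in a common $C(\mathrm{Stone}(C),\mathbb C)$, and all operations are computed on representatives. A morphism $f\colon P\to P'$ induces $Ff\colon F(P)\to F(P')$. If $A$ is a piecewise AW*-algebra or of the form $F(P)$, a \emph{group in $U(A)$ generated by symmetries} is a subset $G\subseteq U(A)$ with a group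 structure such that elements of $G$ commute in $G$ if and only if they are commeasurable in $A$, in which case their products in $G$ and in $A$ agree, with unit $1$ and inverse $*$, and such that $G$ contains, and is generated as a group by, the elements $1-2p$ for $p\in\mathrm{Proj}(A)$. The category $\mathbf{EAWstar}$ of \emph{extended piecewise AW*-algebras} has as objects the tuples $(A,P,G,\cdot)$ where $A$ is a piecewise AW*-algebra; $P$ is a complete orthomodular lattice structure on the set $\mathrm{Proj}(A)$ whose commeasurability, orthocomplement and suprema of commeasurable sets are those of $\mathrm{Proj}(A)$ (with $p^\perp=1-p$); $G$ is a group in $U(A)$ generated by symmetries; and $\cdot$ is an action of $G$ on $A$ by automorphisms of piecewise AW*-algebras with $g\cdot h=ghg^{-1}$ for $g,h\in G$. Morphisms are the morphisms $f\colon A\to A'$ of piecewise AW*-algebras that restrict to a morphism $P\to P'$ of complete orthomodular lattices and to a group homomorphism $G\to G'$, with $f(u\cdot a)=f(u)\cdot' f(a)$ for $u\in G$, $a\in A$. The category $\mathbf{AL}$ of \emph{active lattices} has as objects the tuples $(P,G,\cdot)$ where $P$ is a complete orthomodular lattice; $G$ is a group in $U(F(P))$ generated by symmetries; and $\cdot$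 is an action of $G$ on $P$ by automorphisms of complete orthomodular lattices such that the induced action on $F(P)$ satisfies $F(g\cdot(-))(h)=ghg^{-1}$ for $g,h\in G$. Morphisms are the morphisms $f\colon P\to P'$ of complete orthomodular lattices such that $Ff$ restricts to a group homomorphism $G\to G'$ and $f(u\cdot p)=Ff(u)\cdot' f(p)$ for $u\in G$, $p\in P$. \textbf{Proposition.} The categories $\mathbf{EAWstar}$ and $\mathbf{AL}$ are equivalent. -/

import Mathlib

universe u

open CategoryTheory

namespace ActiveLattices

noncomputable section

/-! ### Piecewise structures -/

/-- The operations of a piecewise C*-algebra (no axioms besides reflexivity and symmetry of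
commeasurability). Addition and multiplication are defined on commeasurable pairs only. -/
class PiecewiseOps (A : Type u) extends Zero A, One A, Star A, SMul ℂ A, Norm A where
  Comm : A → A → Prop
  comm_refl : ∀ a, Comm a a
  comm_symm : ∀ a b, Comm a b → Comm b a
  add : ∀ a b, Comm a b → A
  mul : ∀ a b, Comm a b → A

open PiecewiseOps (Comm comm_refl comm_symm)

/-- A set of pairwise commeasurable elements. -/
def PairwiseComm {A : Type u} [PiecewiseOps A] (S : Set A) : Prop :=
  ∀ a ∈ S, ∀ b ∈ S, Comm a b

/-- Projections: self-adjoint idempotents. -/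
abbrev Proj (A : Type u) [PiecewiseOps A] : Type u :=
  {p : A // star p = p ∧ PiecewiseOps.mul p p (comm_refl p) = p}

/-- Pairwise commeasurable sets of projections. -/
def PairwiseCommProj {A : Type u} [PiecewiseOps A] (X : Set (Proj A)) : Prop :=
  ∀ p ∈ X, ∀ q ∈ X, Comm (p : A) (q : A)

/-- The C*-algebra structure on the pairwise commeasurable set `T` is given by the operations of
the piecewise algebra `A`. -/
structure IsCommCStarOn {A : Type u} [PiecewiseOps A] (T : Set A) [CommCStarAlgebra T] :
    Prop where
  pairwiseComm : PairwiseComm T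
  coe_zero : ((0 : T) : A) = 0
  coe_one : ((1 : T) : A) = 1
  coe_star : ∀ a : T, ((star a : T) : A) = star (a : A)
  coe_smul : ∀ (z : ℂ) (a : T), ((z • a : T) : A) = z • (a : A)
  norm_coe : ∀ a : T, ‖(a : A)‖ = ‖a‖
  coe_add : ∀ (a b : T) (h : Comm (a : A) (b : A)), ((a + b : T) : A) = PiecewiseOps.add _ _ h
  coe_mul : ∀ (a b : T) (h : Comm (a : A) (b : A)), ((a * b : T) : A) = PiecewiseOps.mul _ _ h

/-- A piecewise C*-algebra. -/
class PiecewiseCStarAlgebra (A : Type u) extends PiecewiseOps A where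
  exists_commCStar : ∀ S : Set A, PairwiseComm S →
    ∃ T : Set A, S ⊆ T ∧ ∃ _ : CommCStarAlgebra T, IsCommCStarOn T

/-- An AW*-algebra: a C*-algebra in which the right annihilator of every subset is generated, as a
right ideal, by a projection. -/
def IsAWStar (R : Type u) [CStarAlgebra R] : Prop :=
  ∀ S : Set R, ∃ p : R, IsStarProjection p ∧
    {y : R | ∀ x ∈ S, x * y = 0} = Set.range (fun r : R => p * r)

/-- The set `T` forms a commutative AW*-algebra under the operations of the piecewise algebra `A`
and the given operations `rp` (right supporting projection) and `sup` (suprema of commeasurable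
sets of projections). Recall that `p ≤ q` means `p * q = p` for projections. -/
structure IsCommAWStarOn {A : Type u} [PiecewiseOps A] (rp : A → Proj A)
    (sup : ∀ X : Set (Proj A), PairwiseCommProj X → Proj A)
    (T : Set A) [CommCStarAlgebra T] : Prop extends IsCommCStarOn T where
  isAWStar : IsAWStar T
  coe_rp : ∀ a : T, ∃ p : T, (p : A) = rp a ∧ a * p = a ∧
    ∀ q : T, IsStarProjection q → a * q = a → p * q = p
  coe_sup : ∀ (X : Set (Proj A)) (hX : PairwiseCommProj X), (∀ x ∈ X, (x : A) ∈ T) →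
    ∃ p : T, (p : A) = sup X hX ∧
      (∀ x : T, (∃ y ∈ X, (y : A) = x) → x * p = x) ∧
      ∀ q : T, IsStarProjection q → (∀ x : T, (∃ y ∈ X, (y : A) = x) → x * q = x) → p * q = p

/-- A piecewise AW*-algebra. Every commeasurable set `S` is contained in a commeasurable set `T S`
forming a commutative AW*-algebra, and coherently so: if `S ⊆ S'` then `T S` is an AW*-subalgebra
of `T S'`. (Since all operations, including `rp` and `sup`, are those of `A`, the inclusion
`T S ⊆ T S'` says precisely this.) -/
class PiecewiseAWStar (A : Type u) extends PiecewiseCStarAlgebra A where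
  rp : A → Proj A
  sup : ∀ X : Set (Proj A), PairwiseCommProj X → Proj A
  exists_commAWStar : ∃ T : Set A → Set A,
    (∀ S, PairwiseComm S →
      S ⊆ T S ∧ ∃ _ : CommCStarAlgebra (T S), IsCommAWStarOn rp sup (T S)) ∧
    ∀ S S', PairwiseComm S → PairwiseComm S' → S ⊆ S' → T S ⊆ T S'

/-- A map preserving commeasurability, the partial ring operations, scalars, involution and unit. -/
structure IsPiecewiseHom {A B : Type u} [PiecewiseOps A] [PiecewiseOps B] (f : A → B) :
    Prop where
  map_comm : ∀ a b, Comm a b → Comm (f a) (f b)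
  map_mul : ∀ a b (h : Comm a b),
    f (PiecewiseOps.mul a b h) = PiecewiseOps.mul (f a) (f b) (map_comm a b h)
  map_add : ∀ a b (h : Comm a b),
    f (PiecewiseOps.add a b h) = PiecewiseOps.add (f a) (f b) (map_comm a b h)
  map_smul : ∀ (z : ℂ) a, f (z • a) = z • f a
  map_star : ∀ a, f (star a) = star (f a)
  map_one : f 1 = 1

/-- The restriction of a piecewise homomorphism to projections. -/
def projMap {A B : Type u} [PiecewiseOps A] [PiecewiseOps B] {f : A → B}
    (hf : IsPiecewiseHom f) (p : Proj A) : Proj B :=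
  ⟨f p, by rw [← hf.map_star, p.2.1], by
    rw [← hf.map_mul _ _ (comm_refl (p : A)), p.2.2]⟩

theorem pairwiseCommProj_image {A B : Type u} [PiecewiseOps A] [PiecewiseOps B] {f : A → B}
    (hf : IsPiecewiseHom f) {X : Set (Proj A)} (hX : PairwiseCommProj X) :
    PairwiseCommProj (projMap hf '' X) := by
  rintro _ ⟨p, hp, rfl⟩ _ ⟨q, hq, rfl⟩
  exact hf.map_comm _ _ (hX p hp q hq)

/-- Morphisms of piecewise AW*-algebras. -/
structure IsPiecewiseAWHom {A B : Type u} [PiecewiseAWStar A] [PiecewiseAWStar B] (f : A → B) :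
    Prop extends IsPiecewiseHom f where
  map_sup : ∀ (X : Set (Proj A)) (hX : PairwiseCommProj X),
    projMap toIsPiecewiseHom (PiecewiseAWStar.sup X hX) =
      PiecewiseAWStar.sup (projMap toIsPiecewiseHom '' X)
        (pairwiseCommProj_image toIsPiecewiseHom hX)

theorem IsPiecewiseHom.id {A : Type u} [PiecewiseOps A] : IsPiecewiseHom (id : A → A) :=
  ⟨fun _ _ h => h, fun _ _ _ => rfl, fun _ _ _ => rfl, fun _ _ => rfl, fun _ => rfl, rfl⟩

theorem IsPiecewiseHom.comp {A B C : Type u} [PiecewiseOps A] [PiecewiseOps B] [PiecewiseOps C]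
    {g : B → C} {f : A → B} (hg : IsPiecewiseHom g) (hf : IsPiecewiseHom f) :
    IsPiecewiseHom (g ∘ f) where
  map_comm a b h := hg.map_comm _ _ (hf.map_comm a b h)
  map_mul a b h := by simp only [Function.comp_apply, hf.map_mul a b h, hg.map_mul]
  map_add a b h := by simp only [Function.comp_apply, hf.map_add a b h, hg.map_add]
  map_smul z a := by simp only [Function.comp_apply, hf.map_smul, hg.map_smul]
  map_star a := by simp only [Function.comp_apply, hf.map_star, hg.map_star]
  map_one := by simp only [Function.comp_apply, hf.map_one, hg.map_one]

theorem projMap_id {A : Type u} [PiecewiseOps A] :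
    projMap (IsPiecewiseHom.id (A := A)) = id := rfl

theorem projMap_comp {A B C : Type u} [PiecewiseOps A] [PiecewiseOps B] [PiecewiseOps C]
    {g : B → C} {f : A → B} (hg : IsPiecewiseHom g) (hf : IsPiecewiseHom f) :
    projMap (hg.comp hf) = projMap hg ∘ projMap hf := rfl

theorem IsPiecewiseAWHom.id {A : Type u} [PiecewiseAWStar A] :
    IsPiecewiseAWHom (id : A → A) where
  toIsPiecewiseHom := IsPiecewiseHom.id
  map_sup X hX := by
    simp only [projMap_id, Set.image_id]
    rfl

theorem IsPiecewiseAWHom.comp {A B C : Type u} [PiecewiseAWStar A] [PiecewiseAWStar B]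
    [PiecewiseAWStar C] {g : B → C} {f : A → B} (hg : IsPiecewiseAWHom g)
    (hf : IsPiecewiseAWHom f) : IsPiecewiseAWHom (g ∘ f) where
  toIsPiecewiseHom := hg.toIsPiecewiseHom.comp hf.toIsPiecewiseHom
  map_sup X hX := by
    have h := congrArg (projMap hg.toIsPiecewiseHom) (hf.map_sup X hX)
    rw [hg.map_sup] at h
    simp only [← Set.image_comp] at h
    exact h

/-- The unitary elements of a piecewise algebra. -/
def unitaries (A : Type u) [PiecewiseOps A] : Set A :=
  {a | ∃ h : Comm a (star a), PiecewiseOps.mul a (star a) h = 1}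

/-- The elements `1 - 2p` for projections `p`. -/
def symmetries (A : Type u) [PiecewiseOps A] : Set A :=
  {s | ∃ (p : Proj A) (h : Comm (1 : A) ((-2 : ℂ) • (p : A))), s = PiecewiseOps.add _ _ h}

/-- The group `G`, regarded as a piecewise group with commuting elements as the commeasurable ones,
is a piecewise subgroup of the unitaries of `A`. -/
structure IsPiecewiseSubgroup {A : Type u} [PiecewiseOps A] (G : Set A) [Group G] : Prop where
  subset_unitaries : G ⊆ unitaries A
  comm_iff : ∀ g h : G, Comm (g : A) (h : A) ↔ g * h = h * g
  coe_mul : ∀ (g h : G) (hc : Comm (g : A) (h : A)),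
    ((g * h : G) : A) = PiecewiseOps.mul _ _ hc
  coe_one : ((1 : G) : A) = 1
  coe_inv : ∀ g : G, ((g⁻¹ : G) : A) = star (g : A)

/-! ### Complete orthomodular lattices -/

/-- Complete orthomodular lattices. -/
class CompleteOrthomodularLattice (P : Type u) extends CompleteLattice P, Compl P where
  compl_antitone : ∀ p q : P, p ≤ q → qᶜ ≤ pᶜ
  compl_involutive : ∀ p : P, pᶜᶜ = p
  sup_compl : ∀ p : P, p ⊔ pᶜ = ⊤
  inf_compl : ∀ p : P, p ⊓ pᶜ = ⊥
  orthomodular : ∀ p q : P, p ≤ q → p ⊔ (pᶜ ⊓ q) = q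

/-- Commeasurability in an orthomodular lattice: there are pairwise orthogonal `p'`, `q'`, `r` with
`p = p' ⊔ r` and `q = q' ⊔ r`. -/
def LatComm {P : Type u} [CompleteOrthomodularLattice P] (p q : P) : Prop :=
  ∃ p' q' r : P, p' ≤ q'ᶜ ∧ p' ≤ rᶜ ∧ q' ≤ rᶜ ∧ p = p' ⊔ r ∧ q = q' ⊔ r

/-- Morphisms of complete orthomodular lattices. -/
structure IsCOMLHom {P Q : Type u} [CompleteOrthomodularLattice P]
    [CompleteOrthomodularLattice Q] (f : P → Q) : Prop where
  map_compl : ∀ p, f pᶜ = (f p)ᶜ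
  map_sSup : ∀ S : Set P, f (sSup S) = sSup (f '' S)

theorem IsCOMLHom.id {P : Type u} [CompleteOrthomodularLattice P] :
    IsCOMLHom (id : P → P) :=
  ⟨fun _ => rfl, fun S => by simp⟩

theorem IsCOMLHom.comp {P Q R : Type u} [CompleteOrthomodularLattice P]
    [CompleteOrthomodularLattice Q] [CompleteOrthomodularLattice R] {g : Q → R} {f : P → Q}
    (hg : IsCOMLHom g) (hf : IsCOMLHom f) : IsCOMLHom (g ∘ f) :=
  ⟨fun p => by simp only [Function.comp_apply, hf.map_compl, hg.map_compl],
   fun S => by rw [Function.comp_apply, hf.map_sSup, hg.map_sSup, Set.image_comp]⟩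

theorem IsCOMLHom.map_sup {P Q : Type u} [CompleteOrthomodularLattice P]
    [CompleteOrthomodularLattice Q] {f : P → Q} (hf : IsCOMLHom f) (p q : P) :
    f (p ⊔ q) = f p ⊔ f q := by
  have h := hf.map_sSup {p, q}
  rwa [Set.image_pair, sSup_pair, sSup_pair] at h

theorem IsCOMLHom.monotone {P Q : Type u} [CompleteOrthomodularLattice P]
    [CompleteOrthomodularLattice Q] {f : P → Q} (hf : IsCOMLHom f) : Monotone f := by
  intro p q h
  rw [← sup_eq_right] at h ⊢
  rw [← hf.map_sup, h]

theorem IsCOMLHom.latComm {P Q : Type u} [CompleteOrthomodularLattice P]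
    [CompleteOrthomodularLattice Q] {f : P → Q} (hf : IsCOMLHom f) {p q : P}
    (h : LatComm p q) : LatComm (f p) (f q) := by
  obtain ⟨p', q', r, h1, h2, h3, rfl, rfl⟩ := h
  refine ⟨f p', f q', f r, ?_, ?_, ?_, hf.map_sup _ _, hf.map_sup _ _⟩
  · rw [← hf.map_compl]; exact hf.monotone h1
  · rw [← hf.map_compl]; exact hf.monotone h2
  · rw [← hf.map_compl]; exact hf.monotone h3

/-! ### The piecewise algebra `F(P)` of a complete orthomodular lattice -/

section FunctorF

variable {P Q R : Type u} [CompleteOrthomodularLattice P] [CompleteOrthomodularLattice Q]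
  [CompleteOrthomodularLattice R]

/-- A commeasurable complete Boolean subalgebra of `P`: a pairwise commeasurable subset closed
under complements and arbitrary suprema. -/
structure BoolSub (P : Type u) [CompleteOrthomodularLattice P] where
  carrier : Set P
  latComm : ∀ p ∈ carrier, ∀ q ∈ carrier, LatComm p q
  compl_mem : ∀ p ∈ carrier, pᶜ ∈ carrier
  sSup_mem : ∀ S : Set P, S ⊆ carrier → sSup S ∈ carrier

/-- The Stone space of a commeasurable complete Boolean subalgebra: its Boolean homomorphisms to
the two-element Boolean algebra, with the topology of pointwise convergence. -/
def Stone (C : BoolSub P) : Type u :=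
  {φ : C.carrier → Bool // (∀ p q : C.carrier, (q : P) = (p : P)ᶜ → φ q = !φ p) ∧
    ∀ p q r : C.carrier, (r : P) = (p : P) ⊔ (q : P) → φ r = (φ p || φ q)}

instance (C : BoolSub P) : TopologicalSpace (Stone C) :=
  inferInstanceAs (TopologicalSpace {_φ : C.carrier → Bool // _})

theorem Stone.continuous_eval {C : BoolSub P} (p : C.carrier) :
    Continuous fun φ : Stone C => φ.1 p :=
  (continuous_apply p).comp continuous_induced_dom

/-- The algebra of continuous complex functions on the Stone space. -/
abbrev Func (C : BoolSub P) : Type u := C(Stone C, ℂ)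

/-- Restriction of homomorphisms along an inclusion of subalgebras. -/
def stoneRes {C D : BoolSub P} (h : C.carrier ⊆ D.carrier) : C(Stone D, Stone C) where
  toFun φ := ⟨fun p => φ.1 ⟨p, h p.2⟩, fun p q e => φ.2.1 ⟨p, h p.2⟩ ⟨q, h q.2⟩ e,
    fun p q r e => φ.2.2 ⟨p, h p.2⟩ ⟨q, h q.2⟩ ⟨r, h r.2⟩ e⟩
  continuous_toFun := continuous_induced_rng.2
    (continuous_pi fun p : C.carrier => Stone.continuous_eval (⟨p, h p.2⟩ : D.carrier))

/-- `f ∈ Func C` is related to its image in `Func D` whenever `C ⊆ D`. -/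
def FRel (P : Type u) [CompleteOrthomodularLattice P] (x y : Σ C : BoolSub P, Func C) : Prop :=
  ∃ h : x.1.carrier ⊆ y.1.carrier, y.2 = x.2.comp (stoneRes h)

/-- The carrier of `F(P)`: the disjoint union of the algebras `Func C`, modulo the smallest
equivalence relation identifying functions with their images under inclusions `C ⊆ D`. -/
def F (P : Type u) [CompleteOrthomodularLattice P] : Type u := Quot (FRel P)

/-- The class of `f ∈ Func C` in `F(P)`. -/
def F.mk (C : BoolSub P) (f : Func C) : F P := Quot.mk _ ⟨C, f⟩

theorem latComm_bot_right (p : P) : LatComm p ⊥ :=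
  ⟨p, ⊥, ⊥, by
    have h : (⊥ : P)ᶜ = ⊤ := by
      have := CompleteOrthomodularLattice.sup_compl (⊥ : P)
      rwa [bot_sup_eq] at this
    simp [h]⟩

theorem latComm_symm {p q : P} (h : LatComm p q) : LatComm q p := by
  obtain ⟨p', q', r, h1, h2, h3, h4, h5⟩ := h
  refine ⟨q', p', r, ?_, h3, h2, h5, h4⟩
  have := CompleteOrthomodularLattice.compl_antitone _ _ h1
  rwa [CompleteOrthomodularLattice.compl_involutive] at this

theorem latComm_refl (p : P) : LatComm p p :=
  ⟨⊥, ⊥, p, by simp⟩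

theorem compl_bot' : (⊥ : P)ᶜ = ⊤ := by
  have := CompleteOrthomodularLattice.sup_compl (⊥ : P)
  rwa [bot_sup_eq] at this

theorem compl_top' : (⊤ : P)ᶜ = ⊥ := by
  rw [← compl_bot', CompleteOrthomodularLattice.compl_involutive]

/-- The smallest subalgebra `{⊥, ⊤}`. -/
def BoolSub.trivial (P : Type u) [CompleteOrthomodularLattice P] : BoolSub P where
  carrier := {⊥, ⊤}
  latComm := by
    rintro p (rfl | rfl) q (rfl | rfl)
    · exact latComm_refl _
    · exact latComm_symm (latComm_bot_right _)
    · exact latComm_bot_right _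
    · exact latComm_refl _
  compl_mem := by
    rintro p (rfl | rfl)
    · exact Or.inr compl_bot'
    · exact Or.inl compl_top'
  sSup_mem := by
    intro S hS
    by_cases h : (⊤ : P) ∈ S
    · exact Or.inr (top_le_iff.mp (le_sSup h))
    · refine Or.inl (le_bot_iff.mp (sSup_le fun b hb => ?_))
      rcases hS hb with rfl | rfl
      · exact le_rfl
      · exact absurd hb h

/-- The operations on `F(P)`. Two classes are commeasurable if they have representatives in a common
`Func C`, and are then added and multiplied by means of such representatives. The norm of a class
is the supremum norm of a representative. (The results do not depend on the representatives.) -/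
instance : PiecewiseOps (F P) where
  zero := F.mk (BoolSub.trivial P) 0
  one := F.mk (BoolSub.trivial P) 1
  star := Quot.map (fun x => ⟨x.1, star x.2⟩) (by
    rintro ⟨C, f⟩ ⟨D, g⟩ ⟨h, e⟩
    exact ⟨h, (congrArg (fun k => star k) e).trans rfl⟩)
  smul z := Quot.map (fun x => ⟨x.1, z • x.2⟩) (by
    rintro ⟨C, f⟩ ⟨D, g⟩ ⟨h, e⟩
    exact ⟨h, (congrArg (fun k => z • k) e).trans rfl⟩)
  norm x := ⨆ φ, ‖(Quot.out x).2 φ‖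
  Comm x y := ∃ (C : BoolSub P) (f g : Func C), x = F.mk C f ∧ y = F.mk C g
  comm_refl x := by
    obtain ⟨⟨C, f⟩, rfl⟩ := Quot.exists_rep x
    exact ⟨C, f, f, rfl, rfl⟩
  comm_symm := by
    rintro x y ⟨C, f, g, hf, hg⟩
    exact ⟨C, g, f, hg, hf⟩
  add x y h := F.mk h.choose (h.choose_spec.choose + h.choose_spec.choose_spec.choose)
  mul x y h := F.mk h.choose (h.choose_spec.choose * h.choose_spec.choose_spec.choose)

/-- The image of a commeasurable complete Boolean subalgebra under a morphism. -/
def BoolSub.map {f : P → Q} (hf : IsCOMLHom f) (C : BoolSub P) : BoolSub Q where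
  carrier := f '' C.carrier
  latComm := by
    rintro _ ⟨p, hp, rfl⟩ _ ⟨q, hq, rfl⟩
    exact hf.latComm (C.latComm p hp q hq)
  compl_mem := by
    rintro _ ⟨p, hp, rfl⟩
    exact ⟨pᶜ, C.compl_mem p hp, hf.map_compl p⟩
  sSup_mem := by
    intro S hS
    obtain ⟨S', hS', rfl⟩ := Set.subset_image_iff.mp hS
    exact ⟨sSup S', C.sSup_mem S' hS', hf.map_sSup S'⟩

/-- The map of Stone spaces induced by the restriction of a morphism to `C`. -/
def stoneMap {f : P → Q} (hf : IsCOMLHom f) (C : BoolSub P) :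
    C(Stone (C.map hf), Stone C) where
  toFun φ := ⟨fun p => φ.1 ⟨f p, p, p.2, rfl⟩,
    fun p q e => φ.2.1 ⟨f p, p, p.2, rfl⟩ ⟨f q, q, q.2, rfl⟩
      (by change f q = (f p)ᶜ; rw [e, hf.map_compl]),
    fun p q r e => φ.2.2 ⟨f p, p, p.2, rfl⟩ ⟨f q, q, q.2, rfl⟩ ⟨f r, r, r.2, rfl⟩
      (by change f r = f p ⊔ f q; rw [e, hf.map_sup])⟩
  continuous_toFun := continuous_induced_rng.2 (continuous_pi fun p : C.carrier =>
    Stone.continuous_eval (⟨f p, p, p.2, rfl⟩ : (C.map hf).carrier))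

/-- The map `F(f) : F(P) → F(Q)` induced by a morphism `f : P → Q`: on `Func C` it is the
homomorphism `Func C → Func (f '' C)` induced by the restriction of `f` to `C`. -/
def F.map {f : P → Q} (hf : IsCOMLHom f) : F P → F Q :=
  Quot.map (fun x => ⟨x.1.map hf, x.2.comp (stoneMap hf x.1)⟩) (by
    rintro ⟨C, g⟩ ⟨D, g'⟩ ⟨h, e⟩
    exact ⟨Set.image_mono h,
      (congrArg (fun k : Func D => k.comp (stoneMap hf D)) e).trans rfl⟩)

theorem F.map_id (x : F P) : F.map (IsCOMLHom.id (P := P)) x = x := by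
  obtain ⟨⟨C, g⟩, rfl⟩ := Quot.exists_rep x
  refine (Quot.sound ⟨?_, ?_⟩).symm
  · intro p hp
    exact ⟨p, hp, rfl⟩
  · rfl

theorem F.map_comp {g : Q → R} {f : P → Q} (hg : IsCOMLHom g) (hf : IsCOMLHom f) (x : F P) :
    F.map (hg.comp hf) x = F.map hg (F.map hf x) := by
  obtain ⟨⟨C, h⟩, rfl⟩ := Quot.exists_rep x
  refine Quot.sound ⟨?_, ?_⟩
  · rintro _ ⟨p, hp, rfl⟩
    exact ⟨f p, ⟨p, hp, rfl⟩, rfl⟩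
  · rfl

end FunctorF

/-! ### Extended piecewise AW*-algebras -/

/-- Extended piecewise AW*-algebras `(A, P, G, ·)`. Here `P` is a complete orthomodular lattice
structure on `Proj A` whose underlying piecewise complete Boolean algebra (commeasurability,
complement, suprema of commeasurable sets) is that of `Proj A`. -/
structure ExtPiecewiseAWStar : Type (u + 1) where
  A : Type u
  [piecewise : PiecewiseAWStar A]
  [lattice : CompleteOrthomodularLattice (Proj A)]
  latComm_iff : ∀ p q : Proj A, LatComm p q ↔ Comm (p : A) (q : A)
  coe_compl : ∀ p : Proj A, ∃ h : Comm (1 : A) ((-1 : ℂ) • (p : A)),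
    ((pᶜ : Proj A) : A) = PiecewiseOps.add _ _ h
  sSup_eq : ∀ (X : Set (Proj A)) (hX : PairwiseCommProj X), sSup X = PiecewiseAWStar.sup X hX
  G : Set A
  [group : Group G]
  isPiecewiseSubgroup : IsPiecewiseSubgroup G
  symmetries_subset : symmetries A ⊆ G
  closure_symmetries : Subgroup.closure {g : G | (g : A) ∈ symmetries A} = ⊤
  act : G →* Equiv.Perm A
  act_isHom : ∀ g, IsPiecewiseAWHom (act g)
  act_conj : ∀ g h : G, act g (h : A) = ((g * h * g⁻¹ : G) : A)

attribute [instance] ExtPiecewiseAWStar.piecewise ExtPiecewiseAWStar.lattice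
  ExtPiecewiseAWStar.group

/-- Morphisms of extended piecewise AW*-algebras. -/
@[ext]
structure ExtPiecewiseAWStar.Hom (X Y : ExtPiecewiseAWStar.{u}) : Type u where
  toFun : X.A → Y.A
  isHom : IsPiecewiseAWHom toFun
  isCOMLHom : IsCOMLHom (projMap isHom.toIsPiecewiseHom)
  group_equivariant : ∃ φ : X.G →* Y.G, (∀ g : X.G, (φ g : Y.A) = toFun g) ∧
    ∀ (u : X.G) (a : X.A), toFun (X.act u a) = Y.act (φ u) (toFun a)

instance : Category.{u} ExtPiecewiseAWStar.{u} where
  Hom := ExtPiecewiseAWStar.Hom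
  id X := ⟨id, IsPiecewiseAWHom.id, IsCOMLHom.id, MonoidHom.id _, fun _ => rfl, fun _ _ => rfl⟩
  comp f g := ⟨g.toFun ∘ f.toFun, g.isHom.comp f.isHom, g.isCOMLHom.comp f.isCOMLHom, by
    obtain ⟨φ, h1, h2⟩ := f.group_equivariant
    obtain ⟨ψ, h3, h4⟩ := g.group_equivariant
    refine ⟨ψ.comp φ, fun x => ?_, fun u a => ?_⟩
    · simp only [MonoidHom.comp_apply, Function.comp_apply, h3, h1]
    · simp only [MonoidHom.comp_apply, Function.comp_apply, h2, h4]⟩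

/-! ### Active lattices -/

/-- Active lattices `(P, G, ·)`. -/
structure ActiveLattice : Type (u + 1) where
  P : Type u
  [lattice : CompleteOrthomodularLattice P]
  G : Set (F P)
  [group : Group G]
  isPiecewiseSubgroup : IsPiecewiseSubgroup G
  symmetries_subset : symmetries (F P) ⊆ G
  closure_symmetries : Subgroup.closure {g : G | (g : F P) ∈ symmetries (F P)} = ⊤
  act : G →* Equiv.Perm P
  act_isHom : ∀ g, IsCOMLHom (act g)
  act_conj : ∀ g h : G, F.map (act_isHom g) (h : F P) = ((g * h * g⁻¹ : G) : F P)

attribute [instance] ActiveLattice.lattice ActiveLattice.group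

/-- Morphisms of active lattices. -/
@[ext]
structure ActiveLattice.Hom (X Y : ActiveLattice.{u}) : Type u where
  toFun : X.P → Y.P
  isHom : IsCOMLHom toFun
  group_equivariant : ∃ φ : X.G →* Y.G, (∀ g : X.G, (φ g : F Y.P) = F.map isHom g) ∧
    ∀ (u : X.G) (p : X.P), toFun (X.act u p) = Y.act (φ u) (toFun p)

instance : Category.{u} ActiveLattice.{u} where
  Hom := ActiveLattice.Hom
  id X := ⟨id, IsCOMLHom.id, MonoidHom.id _, fun g => (F.map_id (g : F X.P)).symm,
    fun _ _ => rfl⟩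
  comp f g := ⟨g.toFun ∘ f.toFun, g.isHom.comp f.isHom, by
    obtain ⟨φ, h1, h2⟩ := f.group_equivariant
    obtain ⟨ψ, h3, h4⟩ := g.group_equivariant
    refine ⟨ψ.comp φ, fun x => ?_, fun u p => ?_⟩
    · rw [MonoidHom.comp_apply, h3, h1]
      exact (F.map_comp g.isHom f.isHom _).symm
    · simp only [MonoidHom.comp_apply, Function.comp_apply, h2, h4]⟩

end

end ActiveLattices

/-!
A piecewise AW*-algebra is determined by its projections. Indeed, a commutative AW*-algebra is
`C(X)` for an extremally disconnected compact space `X`, which is the Stone space of its complete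
Boolean algebra of projections, and its homomorphisms are determined by their values on projections,
whose linear combinations are dense. Gluing over all commeasurable sets of projections, `F(Proj(A))`
is isomorphic to `A`, and a morphism `F(P) → F(Q)` is induced by its restriction to the lattices
`P ≅ Proj(F(P))` and `Q ≅ Proj(F(Q))`. Hence `P ↦ F(P)`, which leaves the group and its action
unchanged, is fully faithful and essentially surjective.
-/

namespace ActiveLattices

noncomputable section

open PiecewiseOps (Comm comm_refl comm_symm)
open TopologicalSpace (Clopens)

/-! ### Commeasurability in orthomodular lattices -/

section Orthomodular

variable {P : Type u} [CompleteOrthomodularLattice P] {p q r : P} {S X Y : Set P}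

theorem compl_compl' (p : P) : pᶜᶜ = p := CompleteOrthomodularLattice.compl_involutive p

theorem compl_le_compl_iff_le' : pᶜ ≤ qᶜ ↔ q ≤ p := by
  refine ⟨fun h => ?_, CompleteOrthomodularLattice.compl_antitone q p⟩
  simpa only [compl_compl'] using CompleteOrthomodularLattice.compl_antitone _ _ h

theorem le_compl_iff_le_compl' : p ≤ qᶜ ↔ q ≤ pᶜ := by
  rw [← compl_le_compl_iff_le', compl_compl']

theorem compl_sup' (p q : P) : (p ⊔ q)ᶜ = pᶜ ⊓ qᶜ := by
  apply le_antisymm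
  · exact le_inf (compl_le_compl_iff_le'.2 le_sup_left) (compl_le_compl_iff_le'.2 le_sup_right)
  · rw [le_compl_iff_le_compl']
    exact sup_le (le_compl_iff_le_compl'.1 inf_le_left) (le_compl_iff_le_compl'.1 inf_le_right)

theorem compl_inf' (p q : P) : (p ⊓ q)ᶜ = pᶜ ⊔ qᶜ := by
  rw [← compl_compl' (pᶜ ⊔ qᶜ), compl_sup', compl_compl', compl_compl']

theorem latComm_iff_eq_inf_sup_inf_compl : LatComm p q ↔ p = (p ⊓ q) ⊔ (p ⊓ qᶜ) := by
  constructor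
  · rintro ⟨p', q', r, hpq, hpr, _, rfl, rfl⟩
    refine le_antisymm (sup_le ?_ ?_) (sup_le inf_le_left inf_le_left)
    · exact le_sup_of_le_right (le_inf le_sup_left (compl_sup' q' r ▸ le_inf hpq hpr))
    · exact le_sup_of_le_left (le_inf le_sup_right le_sup_right)
  · intro h
    refine ⟨p ⊓ qᶜ, q ⊓ (p ⊓ q)ᶜ, p ⊓ q, ?_, ?_, inf_le_right, ?_, ?_⟩
    · exact inf_le_right.trans (compl_le_compl_iff_le'.2 inf_le_left)
    · exact inf_le_right.trans (compl_le_compl_iff_le'.2 inf_le_right)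
    · rwa [sup_comm]
    · rw [sup_comm, inf_comm q]
      exact (CompleteOrthomodularLattice.orthomodular (p ⊓ q) q inf_le_right).symm

theorem LatComm.compl_right (h : LatComm p q) : LatComm p qᶜ := by
  rw [latComm_iff_eq_inf_sup_inf_compl] at h ⊢
  rwa [compl_compl', sup_comm]

theorem latComm_of_le (h : p ≤ q) : LatComm p q := by
  rw [latComm_iff_eq_inf_sup_inf_compl, inf_eq_left.2 h]
  exact (sup_eq_left.2 inf_le_left).symm

theorem LatComm.sSup_right (h : ∀ q ∈ S, LatComm p q) : LatComm p (sSup S) := by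
  apply latComm_symm
  rw [latComm_iff_eq_inf_sup_inf_compl]
  refine le_antisymm (sSup_le fun q hq => ?_) (sup_le inf_le_left inf_le_left)
  rw [latComm_iff_eq_inf_sup_inf_compl.1 (latComm_symm (h q hq))]
  exact sup_le_sup (inf_le_inf_right _ (le_sSup hq)) (inf_le_inf_right _ (le_sSup hq))

theorem LatComm.inf_compl_sup (h : LatComm p q) : p ⊓ (pᶜ ⊔ q) = p ⊓ q := by
  have hsup : pᶜ ⊔ (p ⊓ qᶜ) = pᶜ ⊔ qᶜ := by
    refine le_antisymm (sup_le_sup_left inf_le_right _) (sup_le le_sup_left ?_)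
    calc qᶜ = (qᶜ ⊓ p) ⊔ (qᶜ ⊓ pᶜ) :=
          latComm_iff_eq_inf_sup_inf_compl.1 (latComm_symm h.compl_right)
      _ ≤ pᶜ ⊔ (p ⊓ qᶜ) :=
          sup_le (le_sup_of_le_right (inf_comm _ _).le) (le_sup_of_le_left inf_le_right)
  simpa only [compl_sup', compl_inf', compl_compl'] using congrArg (·ᶜ) hsup

theorem LatComm.inf_sSup (h : ∀ q ∈ S, LatComm p q) : p ⊓ sSup S = sSup ((p ⊓ ·) '' S) := by
  have hle : sSup ((p ⊓ ·) '' S) ≤ p ⊓ sSup S :=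
    sSup_le (Set.forall_mem_image.2 fun q hq => inf_le_inf_left _ (le_sSup hq))
  have hdisj : (sSup ((p ⊓ ·) '' S))ᶜ ⊓ (p ⊓ sSup S) ≤ (sSup S)ᶜ := by
    rw [le_compl_iff_le_compl']
    refine sSup_le fun q hq => ?_
    rw [le_compl_iff_le_compl']
    calc (sSup ((p ⊓ ·) '' S))ᶜ ⊓ (p ⊓ sSup S) ≤ p ⊓ (p ⊓ q)ᶜ :=
          le_inf (inf_le_right.trans inf_le_left)
            (inf_le_left.trans (compl_le_compl_iff_le'.2 (le_sSup ⟨q, hq, rfl⟩)))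
      _ = p ⊓ qᶜ := by rw [compl_inf', (h q hq).compl_right.inf_compl_sup]
      _ ≤ qᶜ := inf_le_right
  have hbot : (sSup ((p ⊓ ·) '' S))ᶜ ⊓ (p ⊓ sSup S) = ⊥ := by
    rw [← le_bot_iff, ← CompleteOrthomodularLattice.inf_compl (sSup S)]
    exact le_inf (inf_le_right.trans inf_le_right) hdisj
  rw [← CompleteOrthomodularLattice.orthomodular _ _ hle, hbot, sup_bot_eq]

theorem LatComm.inf_sup (hq : LatComm p q) (hr : LatComm p r) :
    p ⊓ (q ⊔ r) = (p ⊓ q) ⊔ (p ⊓ r) := by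
  have h : ∀ x ∈ ({q, r} : Set P), LatComm p x := by
    rintro x (rfl | rfl) <;> assumption
  simpa only [Set.image_pair, sSup_pair] using LatComm.inf_sSup h

/-- The elements of an orthomodular lattice commeasurable with every element of `X`. -/
def commutant (X : Set P) : Set P := {p | ∀ q ∈ X, LatComm p q}

theorem commutant_anti (h : X ⊆ Y) : commutant Y ⊆ commutant X :=
  fun _ hp q hq => hp q (h hq)

theorem subset_commutant_commutant (X : Set P) : X ⊆ commutant (commutant X) :=
  fun _ hp _ hq => latComm_symm (hq _ hp)

namespace BoolSub

/-- A commeasurable complete Boolean subalgebra containing a given pairwise commeasurable set,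
namely its bicommutant. -/
def gen (X : Set P) (hX : ∀ p ∈ X, ∀ q ∈ X, LatComm p q) : BoolSub P where
  carrier := commutant (commutant X)
  latComm _ hp q hq := hp q (commutant_anti hX hq)
  compl_mem _ hp q hq := latComm_symm (latComm_symm (hp q hq)).compl_right
  sSup_mem _ hS q hq := latComm_symm (LatComm.sSup_right fun _ hp => latComm_symm (hS hp q hq))

/-- A commeasurable complete Boolean subalgebra containing a given element. -/
def single (p : P) : BoolSub P :=
  gen {p} (by rintro _ rfl _ rfl; exact latComm_refl _)

theorem mem_single (p : P) : p ∈ (single p).carrier := subset_commutant_commutant _ rfl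

/-- The intersection of two commeasurable complete Boolean subalgebras. -/
def inter (C D : BoolSub P) : BoolSub P where
  carrier := C.carrier ∩ D.carrier
  latComm p hp q hq := C.latComm p hp.1 q hq.1
  compl_mem p hp := ⟨C.compl_mem p hp.1, D.compl_mem p hp.2⟩
  sSup_mem S hS := ⟨C.sSup_mem S (hS.trans Set.inter_subset_left),
    D.sSup_mem S (hS.trans Set.inter_subset_right)⟩

variable {C D : BoolSub P}

theorem inter_subset_left : (C.inter D).carrier ⊆ C.carrier := Set.inter_subset_left

theorem inter_subset_right : (C.inter D).carrier ⊆ D.carrier := Set.inter_subset_right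

theorem bot_mem (C : BoolSub P) : ⊥ ∈ C.carrier := by
  simpa using C.sSup_mem ∅ (Set.empty_subset _)

theorem top_mem (C : BoolSub P) : ⊤ ∈ C.carrier := compl_bot' (P := P) ▸ C.compl_mem _ C.bot_mem

theorem trivial_subset (C : BoolSub P) : (trivial P).carrier ⊆ C.carrier := by
  rintro p (rfl | rfl)
  exacts [C.bot_mem, C.top_mem]

theorem sup_mem (hp : p ∈ C.carrier) (hq : q ∈ C.carrier) : p ⊔ q ∈ C.carrier := by
  rw [← sSup_pair]
  exact C.sSup_mem _ (by rintro x (rfl | rfl) <;> assumption)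

theorem inf_mem (hp : p ∈ C.carrier) (hq : q ∈ C.carrier) : p ⊓ q ∈ C.carrier := by
  rw [← compl_compl' (p ⊓ q), compl_inf']
  exact C.compl_mem _ (sup_mem (C.compl_mem _ hp) (C.compl_mem _ hq))

instance : Lattice C.carrier where
  sup p q := ⟨p ⊔ q, sup_mem p.2 q.2⟩
  inf p q := ⟨p ⊓ q, inf_mem p.2 q.2⟩
  le_sup_left p _ := le_sup_left (a := (p : P))
  le_sup_right p _ := le_sup_right (a := (p : P))
  sup_le _ _ _ h h' := sup_le (α := P) h h'
  inf_le_left p _ := inf_le_left (a := (p : P))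
  inf_le_right p _ := inf_le_right (a := (p : P))
  le_inf _ _ _ h h' := le_inf (α := P) h h'

instance : BooleanAlgebra C.carrier where
  __ := DistribLattice.ofInfSupLe fun p q r : C.carrier =>
    (LatComm.inf_sup (C.latComm p p.2 q q.2) (C.latComm p p.2 r r.2)).le
  compl p := ⟨(p : P)ᶜ, C.compl_mem _ p.2⟩
  top := ⟨⊤, C.top_mem⟩
  bot := ⟨⊥, C.bot_mem⟩
  inf_compl_le_bot p := (CompleteOrthomodularLattice.inf_compl (p : P)).le
  top_le_sup_compl p := (CompleteOrthomodularLattice.sup_compl (p : P)).ge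
  le_top p := le_top (α := P)
  bot_le p := bot_le (α := P)

/-- The order of a subalgebra is complete, with suprema computed in the ambient lattice. -/
theorem isLUB_sSup_image_val (S : Set C.carrier) :
    IsLUB S ⟨sSup (Subtype.val '' S), C.sSup_mem _ (Subtype.coe_image_subset _ _)⟩ :=
  ⟨fun p hp => le_sSup (α := P) ⟨p, hp, rfl⟩,
    fun _ hp => sSup_le (α := P) (Set.forall_mem_image.2 fun _ hq => hp hq)⟩

end BoolSub

end Orthomodular

/-! ### Stone spaces -/

namespace Stone

variable {P : Type u} [CompleteOrthomodularLattice P] {C D : BoolSub P} {p q : C.carrier}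

instance : FunLike (Stone C) C.carrier Bool where
  coe φ := φ.1
  coe_injective := Subtype.val_injective

instance : BoundedLatticeHomClass (Stone C) C.carrier Bool :=
  have map_compl (φ : Stone C) (p : C.carrier) : φ pᶜ = !φ p := φ.2.1 p pᶜ rfl
  have map_sup (φ : Stone C) (p q : C.carrier) : φ (p ⊔ q) = (φ p ⊔ φ q) := φ.2.2 p q _ rfl
  have map_inf (φ : Stone C) (p q : C.carrier) : φ (p ⊓ q) = (φ p ⊓ φ q) := by
    rw [← compl_compl (p ⊓ q), compl_inf, map_compl, map_sup, map_compl, map_compl]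
    exact (Bool.not_or _ _).trans (congrArg₂ _ (Bool.not_not _) (Bool.not_not _))
  have map_top (φ : Stone C) : φ ⊤ = true := by
    rw [← sup_compl_eq_top (x := (⊥ : C.carrier)), map_sup, map_compl]
    exact Bool.or_not_self _
  have map_bot (φ : Stone C) : φ ⊥ = false := by
    rw [← inf_compl_eq_bot (a := (⊤ : C.carrier)), map_inf, map_compl]
    exact Bool.and_not_self _
  { map_sup, map_inf, map_top, map_bot }

/-- The clopen subset of the Stone space given by an element of the Boolean algebra. -/
def basic (p : C.carrier) : Set (Stone C) := {φ | φ p = true}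

theorem mem_basic {φ : Stone C} : φ ∈ basic p ↔ φ p = true := Iff.rfl

theorem isClopen_basic (p : C.carrier) : IsClopen (basic p) :=
  (isClopen_discrete {true}).preimage (continuous_eval p)

theorem basic_compl (p : C.carrier) : basic pᶜ = (basic p)ᶜ := by
  ext φ
  simp [mem_basic]

theorem basic_inf (p q : C.carrier) : basic (p ⊓ q) = basic p ∩ basic q := by
  ext φ
  simp [mem_basic]

instance : CompactSpace (Stone C) := by
  have hc (p : C.carrier) : Continuous fun φ : C.carrier → Bool => φ p := continuous_apply p
  refine isCompact_iff_compactSpace.1 (IsClosed.isCompact ?_)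
  change IsClosed {φ : C.carrier → Bool | _ ∧ _}
  simp only [Set.ofPred_and, Set.ofPred_forall]
  refine .inter (isClosed_iInter fun p => isClosed_iInter fun q => isClosed_iInter fun _ => ?_)
    (isClosed_iInter fun p => isClosed_iInter fun q => isClosed_iInter fun r =>
      isClosed_iInter fun _ => ?_)
  · exact isClosed_eq (hc q) ((continuous_of_discreteTopology (f := not)).comp (hc p))
  · exact isClosed_eq (hc r) ((continuous_of_discreteTopology
      (f := fun x : Bool × Bool => x.1 || x.2)).comp ((hc p).prodMk (hc q)))

instance : T2Space (Stone C) := inferInstanceAs (T2Space {_φ : C.carrier → Bool // _})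

theorem exists_mem_basic_of_ne_bot (hp : p ≠ ⊥) : ∃ φ, φ ∈ basic p := by
  classical
  have hdisj : Disjoint (Order.PFilter.principal p : Set C.carrier)
      (Order.Ideal.principal (⊥ : C.carrier)) :=
    Set.disjoint_left.2 fun q hpq hq => hp (le_bot_iff.1
      ((Order.PFilter.mem_principal.1 hpq).trans (Order.Ideal.mem_principal.1 hq)))
  obtain ⟨J, hJ, -, hpJ⟩ := DistribLattice.prime_ideal_of_disjoint_filter_ideal hdisj
  have mem_compl_iff (q : C.carrier) : qᶜ ∈ J ↔ q ∉ J :=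
    ⟨fun h h' => hJ.toIsProper.top_notMem (sup_compl_eq_top (x := q) ▸ J.sup_mem h' h),
      hJ.compl_mem_of_notMem⟩
  refine ⟨⟨fun q => decide (q ∉ J), fun a b e => ?_, fun a b c e => ?_⟩, ?_⟩
  · obtain rfl : b = aᶜ := Subtype.ext e
    simp [mem_compl_iff]
  · obtain rfl : c = a ⊔ b := Subtype.ext e
    simp [Order.Ideal.sup_mem_iff, ← Bool.not_and]
  · exact decide_eq_true
      (Set.disjoint_left.1 hpJ (Order.PFilter.mem_principal.2 le_rfl))

theorem basic_subset_basic : basic p ⊆ basic q ↔ p ≤ q := by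
  refine ⟨fun h => ?_, fun h φ hφ => top_le_iff.1 (hφ.ge.trans (OrderHomClass.mono φ h))⟩
  rw [← disjoint_compl_right_iff, disjoint_iff]
  by_contra hne
  obtain ⟨φ, hφ⟩ := exists_mem_basic_of_ne_bot hne
  rw [basic_inf, basic_compl] at hφ
  exact hφ.2 (h hφ.1)

theorem exists_basic_subset {φ : Stone C} {U : Set (Stone C)} (hU : IsOpen U) (hφ : φ ∈ U) :
    ∃ p, φ ∈ basic p ∧ basic p ⊆ U := by
  have hdir : Directed (· ⊇ ·) fun p : {p // φ ∈ basic p} => basic p.1 := fun p q =>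
    ⟨⟨p.1 ⊓ q.1, basic_inf p.1 q.1 ▸ ⟨p.2, q.2⟩⟩, basic_subset_basic.2 inf_le_left,
      basic_subset_basic.2 inf_le_right⟩
  have hinter (ψ) (hψ : ψ ∈ ⋂ p : {p // φ ∈ basic p}, basic p.1) : ψ = φ := by
    rw [Set.mem_iInter] at hψ
    refine DFunLike.ext _ _ fun p => ?_
    by_cases hp : φ ∈ basic p
    · exact (hψ ⟨p, hp⟩).trans hp.symm
    · have hψp : ψ ∈ basic pᶜ := hψ ⟨pᶜ, basic_compl p ▸ hp⟩
      rw [basic_compl] at hψp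
      exact (Bool.eq_false_of_not_eq_true hψp).trans (Bool.eq_false_of_not_eq_true hp).symm
  have : Nonempty {p // φ ∈ basic p} := ⟨⊤, map_top φ⟩
  obtain ⟨p, hp⟩ := exists_subset_nhds_of_isCompact' hdir
    (fun p => (isClopen_basic p.1).isClosed.isCompact) (fun p => (isClopen_basic p.1).isClosed)
    fun ψ hψ => hinter ψ hψ ▸ hU.mem_nhds hφ
  exact ⟨p.1, p.2, hp⟩

/-- The supremum of the elements whose basic clopen set lies in `U`; for open `U`, its own basic
clopen set is the closure of `U`. -/
def closureElem (U : Set (Stone C)) : C.carrier :=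
  ⟨sSup (Subtype.val '' {p : C.carrier | basic p ⊆ U}),
    C.sSup_mem _ (Subtype.coe_image_subset _ _)⟩

theorem isLUB_closureElem (U : Set (Stone C)) : IsLUB {p | basic p ⊆ U} (closureElem U) :=
  BoolSub.isLUB_sSup_image_val _

theorem basic_closureElem {U : Set (Stone C)} (hU : IsOpen U) :
    basic (closureElem U) = closure U := by
  refine Set.Subset.antisymm (fun φ hφ => ?_) ?_
  · by_contra hφU
    obtain ⟨p, hφp, hp⟩ := exists_basic_subset isClosed_closure.isOpen_compl hφU
    have hle : closureElem U ≤ pᶜ := (isLUB_closureElem U).2 fun q hq => by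
      rw [← basic_subset_basic, basic_compl]
      exact fun ψ hψ hψp => hp hψp (subset_closure (hq hψ))
    have hφp' := basic_subset_basic.2 hle hφ
    rw [basic_compl] at hφp'
    exact hφp' hφp
  · refine closure_minimal (fun φ hφ => ?_) (isClopen_basic _).isClosed
    obtain ⟨p, hφp, hp⟩ := exists_basic_subset hU hφ
    exact basic_subset_basic.2 ((isLUB_closureElem U).1 hp) hφp

instance : ExtremallyDisconnected (Stone C) where
  open_closure _ hU := basic_closureElem hU ▸ (isClopen_basic _).isOpen

theorem stoneRes_preimage_basic (h : C.carrier ⊆ D.carrier) (p : C.carrier) :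
    stoneRes h ⁻¹' basic p = basic (Set.inclusion h p) := rfl

theorem stoneRes_surjective (h : C.carrier ⊆ D.carrier) : Function.Surjective (stoneRes h) := by
  intro φ
  by_contra hφ
  have hcl : IsClosed (Set.range (stoneRes h)) :=
    (isCompact_range (stoneRes h).continuous).isClosed
  obtain ⟨p, hφp, hp⟩ := exists_basic_subset hcl.isOpen_compl hφ
  have hne : Set.inclusion h p ≠ ⊥ := by
    intro hbot
    obtain rfl : p = ⊥ := Set.inclusion_injective h hbot
    simp [mem_basic] at hφp
  obtain ⟨ψ, hψ⟩ := exists_mem_basic_of_ne_bot hne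
  rw [← stoneRes_preimage_basic h p] at hψ
  exact hp hψ ⟨ψ, rfl⟩

theorem coe_closureElem_preimage_stoneRes (h : C.carrier ⊆ D.carrier) {U : Set (Stone C)}
    (hU : IsOpen U) : (closureElem (stoneRes h ⁻¹' U) : P) = closureElem U := by
  suffices closureElem (stoneRes h ⁻¹' U) = Set.inclusion h (closureElem U) from
    congrArg Subtype.val this
  refine le_antisymm ((isLUB_closureElem _).2 fun q hq => ?_) ?_
  · rw [← basic_subset_basic, ← stoneRes_preimage_basic h (closureElem U), basic_closureElem hU]
    exact hq.trans (Set.preimage_mono subset_closure)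
  · rw [← Subtype.coe_le_coe]
    exact sSup_le (Set.forall_mem_image.2 fun p hp =>
      le_sSup ⟨Set.inclusion h p, Set.preimage_mono (f := stoneRes h) hp, rfl⟩)

end Stone

/-! ### Projections of algebras of continuous functions -/

section ClopenIndicator

variable {X Y : Type*} [TopologicalSpace X] [TopologicalSpace Y] {K L : Clopens X} {f : C(X, ℂ)}

/-- The indicator function of a clopen set; these are the projections of `C(X, ℂ)`. -/
def clopenIndicator (K : Clopens X) : C(X, ℂ) :=
  (LocallyConstant.charFn ℂ K.isClopen).toContinuousMap

open Classical in
theorem clopenIndicator_apply (K : Clopens X) (x : X) :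
    clopenIndicator K x = if x ∈ (K : Set X) then 1 else 0 := by
  exact Set.indicator_apply (K : Set X) 1 x

theorem clopenIndicator_injective : Function.Injective (clopenIndicator (X := X)) := by
  intro K L h
  ext x
  have hx := DFunLike.congr_fun h x
  by_cases hK : x ∈ K <;> by_cases hL : x ∈ L <;> simp [clopenIndicator_apply, hK, hL] at hx ⊢

theorem isStarProjection_clopenIndicator (K : Clopens X) :
    IsStarProjection (clopenIndicator K) := by
  constructor <;> ext x <;> by_cases h : x ∈ K <;> simp [h, clopenIndicator_apply]

theorem clopenIndicator_inf (K L : Clopens X) :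
    clopenIndicator (K ⊓ L) = clopenIndicator K * clopenIndicator L := by
  ext x
  by_cases hK : x ∈ K <;> by_cases hL : x ∈ L <;> simp [hK, hL, clopenIndicator_apply]

theorem clopenIndicator_compl (K : Clopens X) : clopenIndicator Kᶜ = 1 - clopenIndicator K := by
  ext x
  by_cases hK : x ∈ K <;> simp [hK, clopenIndicator_apply]

theorem clopenIndicator_sup (K L : Clopens X) : clopenIndicator (K ⊔ L) =
    clopenIndicator K + clopenIndicator L - clopenIndicator K * clopenIndicator L := by
  rw [← compl_compl (K ⊔ L), compl_sup, clopenIndicator_compl, clopenIndicator_inf,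
    clopenIndicator_compl, clopenIndicator_compl]
  ring

theorem clopenIndicator_bot : clopenIndicator (⊥ : Clopens X) = 0 := by
  ext x
  simp [clopenIndicator_apply]

theorem clopenIndicator_comp (c : C(Y, X)) (K : Clopens X) :
    (clopenIndicator K).comp c = clopenIndicator ⟨c ⁻¹' K, K.isClopen.preimage c.continuous⟩ :=
  rfl

theorem exists_clopenIndicator_eq (hf : IsIdempotentElem f) : ∃ K, clopenIndicator K = f := by
  have hval (x : X) : f x = 0 ∨ f x = 1 :=
    IsIdempotentElem.iff_eq_zero_or_one.1 (DFunLike.congr_fun hf x)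
  have hclosed (z : ℂ) : IsClosed (f ⁻¹' {z}) := isClosed_singleton.preimage f.continuous
  have hcompl : f ⁻¹' {1} = (f ⁻¹' {0})ᶜ := by
    ext x
    rcases hval x with h | h <;> simp [h]
  let K : Clopens X := ⟨f ⁻¹' {1}, hclosed 1, hcompl ▸ (hclosed 0).isOpen_compl⟩
  have hK (x : X) : x ∈ (K : Set X) ↔ f x = 1 := Iff.rfl
  refine ⟨K, ContinuousMap.ext fun x => ?_⟩
  rcases hval x with h | h <;> simp [clopenIndicator_apply, hK, h, -SetLike.mem_coe]

theorem mul_clopenIndicator_eq_left_iff :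
    f * clopenIndicator K = f ↔ Function.support f ⊆ K := by
  simp only [ContinuousMap.ext_iff, Set.subset_def, Function.mem_support]
  refine forall_congr' fun x => ?_
  by_cases h : x ∈ K <;> simp [h, clopenIndicator_apply, eq_comm]

theorem clopenIndicator_mul_eq_left_iff :
    clopenIndicator K * clopenIndicator L = clopenIndicator K ↔ K ≤ L := by
  rw [← clopenIndicator_inf, clopenIndicator_injective.eq_iff, inf_eq_left]

theorem exists_mul_eq_clopenIndicator (h : (K : Set X) ⊆ Function.support f) :
    ∃ g, f * g = clopenIndicator K := by
  let u : C(X, ℂ) := f * clopenIndicator K + clopenIndicator Kᶜ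
  have hu (x : X) : u x ≠ 0 := by
    by_cases hx : x ∈ K
    · simpa [u, hx, clopenIndicator_apply] using h hx
    · simp [u, hx, clopenIndicator_apply]
  refine ⟨⟨fun x => clopenIndicator K x / u x, (map_continuous _).div (map_continuous _) hu⟩, ?_⟩
  ext x
  by_cases hx : x ∈ K
  · have hfx : f x ≠ 0 := h hx
    simp [u, hx, hfx, clopenIndicator_apply]
  · simp [hx, clopenIndicator_apply]

end ClopenIndicator

section TotallyDisconnected

variable {X : Type*} [TopologicalSpace X] [CompactSpace X]

theorem starSubalgebra_topologicalClosure_eq_top_of_clopenIndicator_mem [TotallySeparatedSpace X]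
    {A : StarSubalgebra ℂ C(X, ℂ)} (h : ∀ K, clopenIndicator K ∈ A) :
    A.topologicalClosure = ⊤ := by
  apply ContinuousMap.starSubalgebra_topologicalClosure_eq_top_of_separatesPoints
  intro x y hxy
  obtain ⟨U, hU, hxU, hyU⟩ := exists_isClopen_of_totally_separated hxy
  refine ⟨_, ⟨_, h ⟨U, hU⟩, rfl⟩, ?_⟩
  simp [clopenIndicator_apply, hxU, show y ∉ U from hyU]

variable [T2Space X] [TotallyDisconnectedSpace X]

theorem injective_of_clopenIndicator_ne_zero {R : Type*} [Ring R] {ψ : C(X, ℂ) →+* R}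
    (h : ∀ K ≠ ⊥, ψ (clopenIndicator K) ≠ 0) : Function.Injective ψ := by
  refine (injective_iff_map_eq_zero ψ).2 fun f hf => ?_
  by_contra hne
  obtain ⟨x, hx⟩ := DFunLike.ne_iff.1 hne
  obtain ⟨V, hV, hxV, hVf⟩ := compact_exists_isClopen_in_isOpen f.continuous.isOpen_support hx
  obtain ⟨g, hg⟩ := exists_mul_eq_clopenIndicator (K := ⟨V, hV⟩) hVf
  refine h ⟨V, hV⟩ (fun hbot => ?_) ?_
  · rw [← SetLike.coe_set_eq] at hbot
    exact hbot.subset hxV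
  · rw [← hg, map_mul, hf, zero_mul]

end TotallyDisconnected

/-! ### Commutative AW*-algebras -/

section IsAWStar

theorem range_clopenIndicator_mul {X : Type*} [TopologicalSpace X] (K : Clopens X) :
    Set.range (clopenIndicator K * ·) = {f : C(X, ℂ) | Function.support f ⊆ K} := by
  ext f
  rw [Set.mem_ofPred_eq, ← mul_clopenIndicator_eq_left_iff, mul_comm]
  constructor
  · rintro ⟨g, rfl⟩
    rw [← mul_assoc, (isStarProjection_clopenIndicator K).isIdempotentElem.eq]
  · exact fun h => ⟨f, h⟩

theorem forall_mul_eq_zero_iff_disjoint_support {X : Type*} [TopologicalSpace X]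
    {S : Set C(X, ℂ)} {g : C(X, ℂ)} : (∀ f ∈ S, f * g = 0) ↔
      Disjoint (closure (⋃ f ∈ S, Function.support f)) (Function.support g) := by
  have hclosure : Disjoint (closure (⋃ f ∈ S, Function.support f)) (Function.support g) ↔
      Disjoint (⋃ f ∈ S, Function.support f) (Function.support g) :=
    ⟨fun h => h.mono_left subset_closure, fun h => h.closure_left g.continuous.isOpen_support⟩
  simp only [hclosure, Set.disjoint_iUnion_left]
  refine forall₂_congr fun f _ => ?_
  rw [Set.disjoint_iff_inter_eq_empty, ← Function.support_mul, Function.support_eq_empty_iff]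
  exact (DFunLike.coe_fn_eq (f := f * g) (g := 0)).symm

theorem exists_support_subset {X : Type*} [TopologicalSpace X] [CompactSpace X] [T2Space X]
    {U : Set X} (hU : IsOpen U) {x : X} (hx : x ∈ U) :
    ∃ f : C(X, ℂ), x ∈ Function.support f ∧ Function.support f ⊆ U := by
  obtain ⟨f, hf0, hf1, -⟩ := exists_continuous_zero_one_of_isClosed hU.isClosed_compl
    (isClosed_singleton (x := x)) (Set.disjoint_singleton_right.2 (· hx))
  refine ⟨⟨fun y => (f y : ℂ), by fun_prop⟩, ?_, fun y hy => ?_⟩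
  · simp [hf1 rfl]
  · by_contra hyU
    exact hy (by simp [hf0 hyU])

variable {X : Type u} [TopologicalSpace X] [CompactSpace X] [T2Space X]

theorem isAWStar_continuousMap_iff : IsAWStar C(X, ℂ) ↔ ExtremallyDisconnected X := by
  simp only [IsAWStar, forall_mul_eq_zero_iff_disjoint_support]
  constructor
  · refine fun h => ⟨fun U hU => ?_⟩
    obtain ⟨p, hp, hann⟩ := h {f | Function.support f ⊆ U}
    obtain ⟨K, rfl⟩ := exists_clopenIndicator_eq hp.isIdempotentElem
    have hiUnion : (⋃ f ∈ {f : C(X, ℂ) | Function.support f ⊆ U}, Function.support f) = U := by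
      refine Set.Subset.antisymm (Set.iUnion₂_subset fun _ hf => hf) fun x hx => ?_
      obtain ⟨f, hxf, hf⟩ := exists_support_subset hU hx
      exact Set.mem_biUnion hf hxf
    rw [range_clopenIndicator_mul, hiUnion, Set.ext_iff] at hann
    suffices closure U = (K : Set X)ᶜ from this ▸ K.isClopen.compl.isOpen
    refine Set.Subset.antisymm (fun x hxU hxK => ?_) (fun x hxK => ?_)
    · exact Set.disjoint_left.1 ((hann (clopenIndicator K)).2
        (mul_clopenIndicator_eq_left_iff.1 (isStarProjection_clopenIndicator K).isIdempotentElem))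
        hxU (by simpa [clopenIndicator_apply] using hxK)
    · by_contra hxU
      obtain ⟨f, hxf, hf⟩ := exists_support_subset isClosed_closure.isOpen_compl hxU
      exact hxK ((hann f).1 (Set.disjoint_left.2 fun y hy hyf => hf hyf hy) hxf)
  · intro _ S
    have hopen : IsOpen (⋃ f ∈ S, Function.support f) :=
      isOpen_biUnion fun f _ => f.continuous.isOpen_support
    let K : Clopens X :=
      ⟨closure (⋃ f ∈ S, Function.support f), isClosed_closure,
        ExtremallyDisconnected.open_closure _ hopen⟩
    refine ⟨clopenIndicator Kᶜ, isStarProjection_clopenIndicator _, ?_⟩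
    rw [range_clopenIndicator_mul]
    ext g
    exact Set.disjoint_left.trans ⟨fun h x hxg hxK => h hxK hxg, fun h x hxK hxg => h hxg hxK⟩

theorem IsAWStar.of_starAlgEquiv {R T : Type u} [CStarAlgebra R] [CStarAlgebra T]
    (h : IsAWStar R) (e : T ≃⋆ₐ[ℂ] R) : IsAWStar T := by
  intro S
  obtain ⟨p, hp, hS⟩ := h (e '' S)
  refine ⟨e.symm p, hp.map e.symm, ?_⟩
  ext y
  have he : Function.Injective e := EquivLike.injective e
  have hy := Set.ext_iff.1 hS (e y)
  simp only [Set.mem_ofPred_eq, Set.forall_mem_image, ← map_mul, map_eq_zero_iff e he] at hy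
  rw [Set.mem_ofPred_eq, hy]
  constructor
  · rintro ⟨r, hr⟩
    exact ⟨e.symm r, he (by rwa [map_mul, e.apply_symm_apply, e.apply_symm_apply])⟩
  · rintro ⟨r, rfl⟩
    exact ⟨e r, by rw [map_mul, e.apply_symm_apply]⟩

theorem isClosed_range_starAlgHom {R S : Type*} [CommCStarAlgebra R] [CStarAlgebra S]
    {φ : R →⋆ₐ[ℂ] S} (hφ : Function.Injective φ) : IsClosed (φ.range : Set S) :=
  (NonUnitalStarAlgHom.isometry φ hφ).isClosedEmbedding.isClosed_range

variable {R : Type u} {S : Type*} [CommCStarAlgebra R]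

theorem IsAWStar.extremallyDisconnected_characterSpace (hR : IsAWStar R) :
    ExtremallyDisconnected (WeakDual.characterSpace ℂ R) :=
  isAWStar_continuousMap_iff.1 (hR.of_starAlgEquiv (gelfandStarTransform R).symm)

theorem IsAWStar.mem_of_isStarProjection_mem (hR : IsAWStar R) {A : StarSubalgebra ℂ R}
    (hA : IsClosed (A : Set R)) (h : ∀ p, IsStarProjection p → p ∈ A) (x : R) : x ∈ A := by
  have := hR.extremallyDisconnected_characterSpace
  let e := gelfandStarTransform R
  let B : StarSubalgebra ℂ C(WeakDual.characterSpace ℂ R, ℂ) :=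
    A.comap (e.symm : C(WeakDual.characterSpace ℂ R, ℂ) →⋆ₐ[ℂ] R)
  have hB : IsClosed (B : Set C(WeakDual.characterSpace ℂ R, ℂ)) :=
    hA.preimage (StarAlgEquiv.isometry e.symm).continuous
  have htop : B.topologicalClosure = ⊤ :=
    starSubalgebra_topologicalClosure_eq_top_of_clopenIndicator_mem fun K =>
      h _ ((isStarProjection_clopenIndicator K).map e.symm)
  have hx : e x ∈ B.topologicalClosure := htop ▸ StarSubalgebra.mem_top
  rw [← SetLike.mem_coe, StarSubalgebra.topologicalClosure_coe, hB.closure_eq] at hx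
  simpa [B] using hx

open scoped CStarAlgebra in
theorem IsAWStar.starAlgHom_ext [CStarAlgebra S] (hR : IsAWStar R) {φ ψ : R →⋆ₐ[ℂ] S}
    (h : ∀ p, IsStarProjection p → φ p = ψ p) : φ = ψ :=
  StarAlgHom.ext (hR.mem_of_isStarProjection_mem (A := StarAlgHom.equalizer φ ψ)
    (isClosed_eq (map_continuous φ) (map_continuous ψ)) h)

theorem IsAWStar.surjective_of_isStarProjection_mem_range [CommCStarAlgebra S] (hR : IsAWStar R)
    {φ : S →⋆ₐ[ℂ] R} (hφ : Function.Injective φ) (h : ∀ p, IsStarProjection p → p ∈ φ.range) :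
    Function.Surjective φ :=
  hR.mem_of_isStarProjection_mem (isClosed_range_starAlgHom hφ) h

open scoped CStarAlgebra in
theorem IsAWStar.exists_comp_eq {T : Type*} [CommCStarAlgebra S] [CStarAlgebra T]
    (hR : IsAWStar R) {ι : S →⋆ₐ[ℂ] T} (hι : Function.Injective ι) {φ : R →⋆ₐ[ℂ] T}
    (h : ∀ p, IsStarProjection p → φ p ∈ ι.range) : ∃ χ : R →⋆ₐ[ℂ] S, ι.comp χ = φ := by
  have hφ : ∀ x, φ x ∈ ι.range := hR.mem_of_isStarProjection_mem (A := ι.range.comap φ)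
    ((isClosed_range_starAlgHom hι).preimage (map_continuous φ)) h
  let e : S ≃⋆ₐ[ℂ] ι.range := StarAlgEquiv.ofInjective ι hι
  refine ⟨(e.symm : ι.range →⋆ₐ[ℂ] S).comp (φ.codRestrict ι.range hφ), StarAlgHom.ext fun x => ?_⟩
  exact congrArg Subtype.val (e.apply_symm_apply ⟨φ x, hφ x⟩)

end IsAWStar

/-! ### The universal property of the algebra of functions on a Stone space -/

section CharFn

variable {P : Type u} [CompleteOrthomodularLattice P] {C D : BoolSub P}

/-- The projection of `Func C` corresponding to an element of `C`. -/
def charFn (p : C.carrier) : Func C := clopenIndicator ⟨Stone.basic p, Stone.isClopen_basic p⟩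

theorem isAWStar_func (C : BoolSub P) : IsAWStar (Func C) :=
  isAWStar_continuousMap_iff.2 inferInstance

theorem exists_charFn_eq {f : Func C} (hf : IsIdempotentElem f) : ∃ p, charFn p = f := by
  obtain ⟨K, rfl⟩ := exists_clopenIndicator_eq hf
  refine ⟨Stone.closureElem K, congrArg clopenIndicator (SetLike.coe_injective ?_)⟩
  exact (Stone.basic_closureElem K.isClopen.isOpen).trans K.isClopen.isClosed.closure_eq

theorem charFn_compl (p : C.carrier) : charFn pᶜ = 1 - charFn p :=
  (congrArg clopenIndicator (SetLike.coe_injective (Stone.basic_compl p))).trans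
    (clopenIndicator_compl _)

theorem charFn_mul_eq_left_iff {p q : C.carrier} : charFn p * charFn q = charFn p ↔ p ≤ q :=
  clopenIndicator_mul_eq_left_iff.trans Stone.basic_subset_basic

theorem Stone.exists_preimage_basic_eq {Y : Type*} [TopologicalSpace Y]
    (K : C.carrier → Clopens Y) (hcompl : ∀ p, K pᶜ = (K p)ᶜ)
    (hsup : ∀ p q, K (p ⊔ q) = K p ⊔ K q) : ∃ c : C(Y, Stone C), ∀ p, c ⁻¹' basic p = K p := by
  classical
  let φ (y : Y) : Stone C := ⟨fun p => decide (y ∈ (K p : Set Y)), fun p q e => by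
    obtain rfl : q = pᶜ := Subtype.ext e
    simp [hcompl, -SetLike.mem_coe], fun p q r e => by
    obtain rfl : r = p ⊔ q := Subtype.ext e
    simp [hsup, -SetLike.mem_coe]⟩
  have hφ (p : C.carrier) : φ ⁻¹' basic p = K p := by
    ext y
    exact decide_eq_true_iff
  refine ⟨⟨φ, continuous_induced_rng.2 (continuous_pi fun p => ?_)⟩, hφ⟩
  exact continuous_bool_rng true |>.2 (hφ p ▸ (K p).isClopen)

theorem exists_starAlgHom_charFn {R : Type*} [CommCStarAlgebra R] {ι : C.carrier → R}
    (hproj : ∀ p, IsStarProjection (ι p)) (hcompl : ∀ p, ι pᶜ = 1 - ι p)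
    (hsup : ∀ p q, ι (p ⊔ q) = ι p + ι q - ι p * ι q) :
    ∃ ψ : Func C →⋆ₐ[ℂ] R, ∀ p, ψ (charFn p) = ι p := by
  let e := gelfandStarTransform R
  choose K hK using fun p => exists_clopenIndicator_eq ((hproj p).map e).isIdempotentElem
  obtain ⟨c, hc⟩ := Stone.exists_preimage_basic_eq K
    (fun p => clopenIndicator_injective (by
      rw [hK, hcompl, map_sub, map_one, clopenIndicator_compl, hK]))
    (fun p q => clopenIndicator_injective (by
      rw [hK, hsup, map_sub, map_add, map_mul, clopenIndicator_sup, hK, hK]))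
  refine ⟨(e.symm : _ →⋆ₐ[ℂ] R).comp (ContinuousMap.compStarAlgHom' ℂ ℂ c), fun p => ?_⟩
  have hcomp : (charFn p).comp c = clopenIndicator (K p) :=
    (clopenIndicator_comp c _).trans (congrArg clopenIndicator (SetLike.coe_injective (hc p)))
  calc e.symm ((charFn p).comp c) = e.symm (e (ι p)) := by rw [hcomp, hK]
    _ = ι p := e.symm_apply_apply _

end CharFn

/-! ### Representatives of elements of `F(P)` -/

section SpecElem

open TopologicalSpace (Opens)

variable {P : Type u} [CompleteOrthomodularLattice P] {C D : BoolSub P}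

/-- The element of `C` whose clopen subset of the Stone space is the closure of `f ⁻¹' U`. These
elements play the role of the spectral projections of `f`: as elements of `P` they depend only on
the class of `f` in `F(P)`, and they tell which subalgebras carry a representative of that class. -/
def specElem (f : Func C) (U : Opens ℂ) : C.carrier := Stone.closureElem (f ⁻¹' U)

theorem basic_specElem (f : Func C) (U : Opens ℂ) :
    Stone.basic (specElem f U) = closure (f ⁻¹' U) :=
  Stone.basic_closureElem (U.isOpen.preimage f.continuous)

theorem coe_specElem_comp_stoneRes (h : C.carrier ⊆ D.carrier) (f : Func C) (U : Opens ℂ) :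
    (specElem (f.comp (stoneRes h)) U : P) = specElem f U :=
  Stone.coe_closureElem_preimage_stoneRes h (U.isOpen.preimage f.continuous)

theorem apply_eq_apply_of_mem_basic_specElem {f g : Func C} {φ ψ : Stone C}
    (h : ∀ U, φ ∈ Stone.basic (specElem f U) → ψ ∈ Stone.basic (specElem g U)) : f φ = g ψ := by
  simp only [basic_specElem] at h
  by_contra hne
  obtain ⟨U, V, hU, hV, hfU, hgV, hUV⟩ := t2_separation hne
  obtain ⟨χ, hχV, hχU⟩ := mem_closure_iff.1 (h ⟨U, hU⟩ (subset_closure hfU)) (g ⁻¹' V)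
    (hV.preimage g.continuous) hgV
  exact Set.disjoint_left.1 hUV hχU hχV

theorem eq_of_specElem_eq {f g : Func C} (h : specElem f = specElem g) : f = g :=
  ContinuousMap.ext fun _ => apply_eq_apply_of_mem_basic_specElem fun _ => by rw [h]; exact id

theorem exists_comp_stoneRes_eq (h : C.carrier ⊆ D.carrier) {f : Func D}
    (hf : ∀ U, (specElem f U : P) ∈ C.carrier) : ∃ g : Func C, g.comp (stoneRes h) = f := by
  have hq : Topology.IsQuotientMap (stoneRes h) :=
    .of_surjective_continuous (Stone.stoneRes_surjective h) (stoneRes h).continuous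
  refine ⟨hq.lift f fun φ ψ e => apply_eq_apply_of_mem_basic_specElem fun U hU => ?_,
    hq.lift_comp f _⟩
  exact (DFunLike.congr_fun e (⟨specElem f U, hf U⟩ : C.carrier)).symm.trans hU

end SpecElem

namespace F

section Representatives

open TopologicalSpace (Opens)

variable {P : Type u} [CompleteOrthomodularLattice P] {C D : BoolSub P}

theorem exists_mk_eq (x : F P) : ∃ (C : BoolSub P) (f : Func C), F.mk C f = x := by
  obtain ⟨⟨C, f⟩, rfl⟩ := Quot.exists_rep x
  exact ⟨C, f, rfl⟩

theorem mk_comp_stoneRes (h : C.carrier ⊆ D.carrier) (f : Func C) :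
    F.mk D (f.comp (stoneRes h)) = F.mk C f :=
  (Quot.sound (⟨h, rfl⟩ : FRel P ⟨C, f⟩ ⟨D, f.comp (stoneRes h)⟩)).symm

/-- The element `specElem f U` of `P` for any representative `f` of an element of `F(P)`. -/
def spec (x : F P) (U : Opens ℂ) : P :=
  Quot.lift (fun y : Σ C : BoolSub P, Func C => (specElem y.2 U : P)) (by
    rintro ⟨C, f⟩ ⟨D, g⟩ ⟨h, hg : g = f.comp (stoneRes h)⟩
    simp only [hg, coe_specElem_comp_stoneRes]) x

theorem spec_mk (f : Func C) (U : Opens ℂ) : (F.mk C f).spec U = specElem f U := rfl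

theorem mk_injective (C : BoolSub P) : Function.Injective (F.mk C) := fun f g h =>
  eq_of_specElem_eq (funext fun U => Subtype.ext (by rw [← spec_mk, h, spec_mk]))

theorem exists_comp_stoneRes_of_mk_eq {f : Func C} {g : Func D} (h : F.mk C f = F.mk D g) :
    ∃ k : Func (C.inter D), k.comp (stoneRes BoolSub.inter_subset_left) = f ∧
      k.comp (stoneRes BoolSub.inter_subset_right) = g := by
  obtain ⟨k, hk⟩ := exists_comp_stoneRes_eq (C := C.inter D) BoolSub.inter_subset_left (f := f)
    fun U => ⟨(specElem f U).2, by rw [← spec_mk, h]; exact (specElem g U).2⟩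
  refine ⟨k, hk, mk_injective D ?_⟩
  rw [← h, ← hk, mk_comp_stoneRes, mk_comp_stoneRes]

theorem mem_range_mk_iff {x : F P} : x ∈ Set.range (F.mk C) ↔ ∀ U, x.spec U ∈ C.carrier := by
  constructor
  · rintro ⟨f, rfl⟩ U
    exact (specElem f U).2
  · intro h
    obtain ⟨D, f, rfl⟩ := x.exists_mk_eq
    obtain ⟨k, rfl⟩ := exists_comp_stoneRes_eq (C := C.inter D) BoolSub.inter_subset_right (f := f)
      fun U => ⟨h U, (specElem f U).2⟩
    exact ⟨k.comp (stoneRes BoolSub.inter_subset_left), by simp only [mk_comp_stoneRes]⟩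

theorem comm_mk (f g : Func C) : Comm (F.mk C f) (F.mk C g) := ⟨C, f, g, rfl, rfl⟩

theorem mk_add_congr {f f' : Func C} {g g' : Func D} (h : F.mk C f = F.mk D g)
    (h' : F.mk C f' = F.mk D g') : F.mk C (f + f') = F.mk D (g + g') := by
  obtain ⟨k, rfl, rfl⟩ := exists_comp_stoneRes_of_mk_eq h
  obtain ⟨l, rfl, rfl⟩ := exists_comp_stoneRes_of_mk_eq h'
  simp only [← ContinuousMap.add_comp, mk_comp_stoneRes]

theorem mk_mul_congr {f f' : Func C} {g g' : Func D} (h : F.mk C f = F.mk D g)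
    (h' : F.mk C f' = F.mk D g') : F.mk C (f * f') = F.mk D (g * g') := by
  obtain ⟨k, rfl, rfl⟩ := exists_comp_stoneRes_of_mk_eq h
  obtain ⟨l, rfl, rfl⟩ := exists_comp_stoneRes_of_mk_eq h'
  simp only [← ContinuousMap.mul_comp, mk_comp_stoneRes]

theorem add_mk (f g : Func C) (h : Comm (F.mk C f) (F.mk C g)) :
    PiecewiseOps.add _ _ h = F.mk C (f + g) :=
  have hrep := h.choose_spec.choose_spec.choose_spec
  mk_add_congr hrep.1.symm hrep.2.symm

theorem mul_mk (f g : Func C) (h : Comm (F.mk C f) (F.mk C g)) :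
    PiecewiseOps.mul _ _ h = F.mk C (f * g) :=
  have hrep := h.choose_spec.choose_spec.choose_spec
  mk_mul_congr hrep.1.symm hrep.2.symm

theorem star_mk (f : Func C) : star (F.mk C f) = F.mk C (star f) := rfl

theorem smul_mk (z : ℂ) (f : Func C) : z • F.mk C f = F.mk C (z • f) := rfl

theorem mk_zero (C : BoolSub P) : F.mk C 0 = 0 := mk_comp_stoneRes C.trivial_subset 0

theorem mk_one (C : BoolSub P) : F.mk C 1 = 1 := mk_comp_stoneRes C.trivial_subset 1

theorem norm_mk (f : Func C) : ‖F.mk C f‖ = ‖f‖ := by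
  have hrep (y : Σ C : BoolSub P, Func C) (h : F.mk y.1 y.2 = F.mk C f) :
      ⨆ φ, ‖y.2 φ‖ = ‖f‖ := by
    obtain ⟨k, hky, rfl⟩ := exists_comp_stoneRes_of_mk_eq h
    rw [← hky, ContinuousMap.norm_eq_iSup_norm]
    exact ((Stone.stoneRes_surjective _).iSup_comp fun φ => ‖k φ‖).trans
      ((Stone.stoneRes_surjective _).iSup_comp fun φ => ‖k φ‖).symm
  exact hrep _ (Quot.out_eq (F.mk C f))

end Representatives

/-! ### Projections of `F(P)` -/

section Projections

variable {P Q : Type u} [CompleteOrthomodularLattice P] [CompleteOrthomodularLattice Q]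
  {C : BoolSub P}

/-- The smallest element of `P` whose projection supports a given element of `F(P)`. -/
def support (x : F P) : P := x.spec ⟨{0}ᶜ, isOpen_compl_singleton⟩

theorem support_mk_mem (f : Func C) : (F.mk C f).support ∈ C.carrier := (specElem f _).2

theorem support_mk_le_iff {f : Func C} {p : C.carrier} :
    (F.mk C f).support ≤ p ↔ f * charFn p = f := by
  refine Stone.basic_subset_basic.symm.trans ?_
  rw [basic_specElem, (Stone.isClopen_basic p).isClosed.closure_subset_iff]
  exact (mul_clopenIndicator_eq_left_iff (K := ⟨_, Stone.isClopen_basic p⟩)).symm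

theorem support_mk_charFn (p : C.carrier) : (F.mk C (charFn p)).support = p :=
  congrArg Subtype.val (eq_of_forall_ge_iff (a := specElem (charFn p) _) fun _ =>
    support_mk_le_iff.trans charFn_mul_eq_left_iff)

theorem isStarProjection_charFn (p : C.carrier) : IsStarProjection (charFn p) :=
  isStarProjection_clopenIndicator _

/-- The projection of `F(P)` given by an element of `P`. -/
def proj (p : P) : Proj (F P) :=
  ⟨F.mk (BoolSub.single p) (charFn ⟨p, BoolSub.mem_single p⟩), by
    rw [star_mk, (isStarProjection_charFn _).isSelfAdjoint.star_eq], by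
    rw [mul_mk, (isStarProjection_charFn _).isIdempotentElem.eq]⟩

theorem coe_proj (p : C.carrier) : (proj (p : P) : F P) = F.mk C (charFn p) := by
  let q : ((BoolSub.single (p : P)).inter C).carrier := ⟨p, BoolSub.mem_single _, p.2⟩
  exact (mk_comp_stoneRes BoolSub.inter_subset_left (charFn q)).trans
    (mk_comp_stoneRes BoolSub.inter_subset_right (charFn q)).symm

theorem support_proj (p : P) : (proj p : F P).support = p := support_mk_charFn _

theorem proj_support (x : Proj (F P)) : proj (x : F P).support = x := by
  obtain ⟨x, hstar, hmul⟩ := x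
  obtain ⟨C, f, rfl⟩ := x.exists_mk_eq
  rw [mul_mk] at hmul
  obtain ⟨p, rfl⟩ := exists_charFn_eq (mk_injective C hmul)
  refine Subtype.ext ?_
  simp only [support_mk_charFn, coe_proj]

/-- The bijection between `P` and the projections of `F(P)`. -/
def projEquiv (P : Type u) [CompleteOrthomodularLattice P] : P ≃ Proj (F P) where
  toFun := proj
  invFun x := (x : F P).support
  left_inv := support_proj
  right_inv := proj_support

theorem coe_proj_inj {p q : P} : (proj p : F P) = proj q ↔ p = q :=
  Subtype.val_inj.trans (projEquiv P).injective.eq_iff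

theorem map_proj {f : P → Q} (hf : IsCOMLHom f) (p : P) : F.map hf (proj p) = proj (f p) :=
  (coe_proj (C := (BoolSub.single p).map hf) ⟨f p, p, BoolSub.mem_single p, rfl⟩).symm

theorem isPiecewiseHom_map {f : P → Q} (hf : IsCOMLHom f) : IsPiecewiseHom (F.map hf) where
  map_comm := by
    rintro _ _ ⟨C, g, k, rfl, rfl⟩
    exact comm_mk (C := C.map hf) _ _
  map_mul := by
    rintro _ _ ⟨C, g, k, rfl, rfl⟩
    rw [mul_mk]
    exact (mul_mk (g.comp (stoneMap hf C)) (k.comp (stoneMap hf C)) (comm_mk _ _)).symm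
  map_add := by
    rintro _ _ ⟨C, g, k, rfl, rfl⟩
    rw [add_mk]
    exact (add_mk (g.comp (stoneMap hf C)) (k.comp (stoneMap hf C)) (comm_mk _ _)).symm
  map_smul z x := by
    obtain ⟨C, g, rfl⟩ := x.exists_mk_eq
    rfl
  map_star x := by
    obtain ⟨C, g, rfl⟩ := x.exists_mk_eq
    rfl
  map_one := mk_one ((BoolSub.trivial P).map hf)

theorem projMap_map {f : P → Q} (hf : IsCOMLHom f) (p : P) :
    projMap (isPiecewiseHom_map hf) (proj p) = proj (f p) :=
  Subtype.ext (map_proj hf p)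

theorem support_projMap_map {f : P → Q} (hf : IsCOMLHom f) (x : Proj (F P)) :
    (projMap (isPiecewiseHom_map hf) x : F Q).support = f (x : F P).support := by
  rw [← proj_support x, projMap_map, support_proj, support_proj]

end Projections

end F

/-! ### Transport of structure along bijections -/

section Transport

/-- The structure of a commutative C*-algebra transported along a bijection. -/
abbrev commCStarAlgebraOfEquiv {T R : Type*} [CommCStarAlgebra R] (e : T ≃ R) :
    CommCStarAlgebra T :=
  letI : CommRing T := e.commRing
  letI : Algebra ℂ T := e.algebra ℂ
  letI : NormedCommRing T := NormedCommRing.induced T R (e.algEquiv ℂ).toAlgHom e.injective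
  letI : NormedAlgebra ℂ T := NormedAlgebra.induced ℂ T R (e.algEquiv ℂ).toAlgHom
  letI : StarRing T := e.starRing
  { toNormedCommRing := inferInstance
    toStarRing := inferInstance
    toNormedAlgebra := inferInstance
    toCompleteSpace := (IsometryEquiv.mk e (AddMonoidHomClass.isometry_of_norm
      (e.algEquiv ℂ).toAlgHom fun _ => rfl)).completeSpace_iff.2 inferInstance
    toCStarRing := ⟨fun a => by
      change ‖e a‖ * ‖e a‖ ≤ ‖e (e.symm (e (e.symm (star (e a))) * e a))‖
      rw [e.apply_symm_apply, e.apply_symm_apply]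
      exact CStarRing.norm_mul_self_le (e a)⟩
    toStarModule := e.starModule ℂ }

/-- The structure of a complete orthomodular lattice transported along a bijection. -/
abbrev completeOrthomodularLatticeOfEquiv {T P : Type u} [CompleteOrthomodularLattice P]
    (e : T ≃ P) : CompleteOrthomodularLattice T :=
  letI := e.completeLattice
  { compl a := e.symm (e a)ᶜ
    compl_antitone p q h := by
      change e (e.symm _) ≤ e (e.symm _)
      simpa only [e.apply_symm_apply] using CompleteOrthomodularLattice.compl_antitone _ _ h
    compl_involutive p := by simp [CompleteOrthomodularLattice.compl_involutive]
    sup_compl p := by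
      change e.symm (e p ⊔ e (e.symm _)) = e.symm ⊤
      rw [e.apply_symm_apply, CompleteOrthomodularLattice.sup_compl]
    inf_compl p := by
      change e.symm (e p ⊓ e (e.symm _)) = e.symm ⊥
      rw [e.apply_symm_apply, CompleteOrthomodularLattice.inf_compl]
    orthomodular p q h := by
      change e.symm (e p ⊔ e (e.symm (e (e.symm _) ⊓ e q))) = q
      rw [e.apply_symm_apply, e.apply_symm_apply, CompleteOrthomodularLattice.orthomodular _ _ h,
        e.symm_apply_apply] }

end Transport

/-! ### `F(P)` is a piecewise AW*-algebra -/

/-- A complete orthomodular lattice structure on `Proj A` whose commeasurability, orthocomplement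
and suprema of commeasurable sets are those of the piecewise AW*-algebra `A`. -/
class IsProjLattice (A : Type u) [PiecewiseAWStar A] [CompleteOrthomodularLattice (Proj A)] :
    Prop where
  latComm_iff : ∀ p q : Proj A, LatComm p q ↔ Comm (p : A) (q : A)
  coe_compl : ∀ p : Proj A, ∃ h : Comm (1 : A) ((-1 : ℂ) • (p : A)),
    ((pᶜ : Proj A) : A) = PiecewiseOps.add _ _ h
  sSup_eq : ∀ (X : Set (Proj A)) (hX : PairwiseCommProj X), sSup X = PiecewiseAWStar.sup X hX

namespace F

section PiecewiseAWStar

variable {P Q : Type u} [CompleteOrthomodularLattice P] [CompleteOrthomodularLattice Q]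
  {C : BoolSub P}

instance : CommCStarAlgebra (Set.range (F.mk C)) :=
  commCStarAlgebraOfEquiv (Equiv.ofInjective _ (mk_injective C)).symm

/-- The subset of `F(P)` of the classes of functions in `Func C`, identified with `Func C`. -/
def funcEquiv (C : BoolSub P) : Func C ≃⋆ₐ[ℂ] Set.range (F.mk C) :=
  .symm { (Equiv.ofInjective _ (mk_injective C)).symm with
    map_mul' _ _ := Equiv.apply_symm_apply _ _
    map_add' _ _ := Equiv.apply_symm_apply _ _
    map_star' _ := Equiv.apply_symm_apply _ _
    map_smul' _ _ := Equiv.apply_symm_apply _ _ }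

theorem coe_funcEquiv (f : Func C) : (funcEquiv C f : F P) = F.mk C f := rfl

theorem funcEquiv_mul_eq_left_iff {f g : Func C} :
    funcEquiv C f * funcEquiv C g = funcEquiv C f ↔ f * g = f := by
  rw [← map_mul, (EquivLike.injective (funcEquiv C)).eq_iff]

theorem exists_funcEquiv_charFn_eq {x : Set.range (F.mk C)} (hx : IsStarProjection x) :
    ∃ p, funcEquiv C (charFn p) = x := by
  obtain ⟨p, hp⟩ := exists_charFn_eq (hx.map (funcEquiv C).symm).isIdempotentElem
  exact ⟨p, (funcEquiv C).symm_apply_eq.1 hp.symm |>.symm⟩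

theorem isCommCStarOn_range (C : BoolSub P) : IsCommCStarOn (Set.range (F.mk C)) where
  pairwiseComm := by
    rintro _ ⟨f, rfl⟩ _ ⟨g, rfl⟩
    exact comm_mk f g
  coe_zero := (congrArg Subtype.val (map_zero (funcEquiv C))).symm.trans (mk_zero C)
  coe_one := (congrArg Subtype.val (map_one (funcEquiv C))).symm.trans (mk_one C)
  coe_star x := by
    obtain ⟨f, rfl⟩ := EquivLike.surjective (funcEquiv C) x
    rw [← map_star, coe_funcEquiv, coe_funcEquiv, star_mk]
  coe_smul z x := by
    obtain ⟨f, rfl⟩ := EquivLike.surjective (funcEquiv C) x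
    rw [← map_smul, coe_funcEquiv, coe_funcEquiv, smul_mk]
  norm_coe x := by
    obtain ⟨f, rfl⟩ := EquivLike.surjective (funcEquiv C) x
    rw [coe_funcEquiv, norm_mk, StarAlgEquiv.norm_map]
  coe_add x y h := by
    obtain ⟨f, rfl⟩ := EquivLike.surjective (funcEquiv C) x
    obtain ⟨g, rfl⟩ := EquivLike.surjective (funcEquiv C) y
    rw [← map_add]
    exact (add_mk f g h).symm
  coe_mul x y h := by
    obtain ⟨f, rfl⟩ := EquivLike.surjective (funcEquiv C) x
    obtain ⟨g, rfl⟩ := EquivLike.surjective (funcEquiv C) y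
    rw [← map_mul]
    exact (mul_mk f g h).symm

theorem isCommAWStarOn_range (C : BoolSub P) :
    IsCommAWStarOn (fun x : F P => proj x.support)
      (fun X _ => proj (sSup ((fun x : Proj (F P) => (x : F P).support) '' X)))
      (Set.range (F.mk C)) where
  toIsCommCStarOn := isCommCStarOn_range C
  isAWStar := (isAWStar_func C).of_starAlgEquiv (funcEquiv C).symm
  coe_rp := by
    rintro ⟨_, f, rfl⟩
    refine ⟨funcEquiv C (charFn ⟨_, support_mk_mem f⟩), (coe_proj _).symm,
      funcEquiv_mul_eq_left_iff.2 (support_mk_le_iff.1 le_rfl), fun q hq h => ?_⟩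
    obtain ⟨q, rfl⟩ := exists_funcEquiv_charFn_eq hq
    exact funcEquiv_mul_eq_left_iff.2 (charFn_mul_eq_left_iff.2
      (support_mk_le_iff.2 (funcEquiv_mul_eq_left_iff.1 h)))
  coe_sup X _ hXC := by
    choose! k hk using hXC
    have hs : sSup ((fun x : Proj (F P) => (x : F P).support) '' X) ∈ C.carrier := by
      refine C.sSup_mem _ ?_
      rintro _ ⟨x, hx, rfl⟩
      simpa only [← hk x hx] using support_mk_mem (k x)
    refine ⟨funcEquiv C (charFn ⟨_, hs⟩), (coe_proj _).symm, ?_, fun q hq h => ?_⟩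
    · rintro ⟨_, f, rfl⟩ ⟨x, hx, hxf⟩
      refine funcEquiv_mul_eq_left_iff.2 (support_mk_le_iff.1 ?_)
      exact le_sSup ⟨x, hx, congrArg support hxf⟩
    · obtain ⟨q, rfl⟩ := exists_funcEquiv_charFn_eq hq
      refine funcEquiv_mul_eq_left_iff.2 (charFn_mul_eq_left_iff.2 (sSup_le (α := P) ?_))
      rintro _ ⟨x, hx, rfl⟩
      change (x : F P).support ≤ (q : P)
      rw [← hk x hx]
      exact support_mk_le_iff.2 (funcEquiv_mul_eq_left_iff.1
        (h (funcEquiv C (k x)) ⟨x, hx, (hk x hx).symm⟩))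

/-- The elements `x.spec U` of `P` for all `x ∈ S`. -/
def specSet (S : Set (F P)) : Set P := {p | ∃ x ∈ S, ∃ U, x.spec U = p}

theorem latComm_of_mem_specSet {S : Set (F P)} (hS : PairwiseComm S) :
    ∀ p ∈ specSet S, ∀ q ∈ specSet S, LatComm p q := by
  rintro _ ⟨x, hx, U, rfl⟩ _ ⟨y, hy, V, rfl⟩
  obtain ⟨C, f, g, rfl, rfl⟩ := hS x hx y hy
  exact C.latComm _ (specElem f U).2 _ (specElem g V).2

/-- The commutative AW*-algebra generated by a commeasurable subset `S` of `F(P)`, consisting of the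
classes of functions in `Func C` for the subalgebra `C` generated by `specSet S`. -/
def genSet (S : Set (F P)) : Set (F P) :=
  {x | ∀ U, x.spec U ∈ commutant (commutant (specSet S))}

theorem genSet_eq_range {S : Set (F P)} (hS : PairwiseComm S) :
    genSet S = Set.range (F.mk (BoolSub.gen (specSet S) (latComm_of_mem_specSet hS))) :=
  Set.ext fun _ =>
    (mem_range_mk_iff (C := BoolSub.gen (specSet S) (latComm_of_mem_specSet hS))).symm

theorem subset_genSet (S : Set (F P)) : S ⊆ genSet S :=
  fun x hx U => subset_commutant_commutant (specSet S) ⟨x, hx, U, rfl⟩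

theorem genSet_mono {S S' : Set (F P)} (h : S ⊆ S') : genSet S ⊆ genSet S' := by
  refine fun x hx U => commutant_anti (commutant_anti ?_) (hx U)
  rintro _ ⟨y, hy, V, rfl⟩
  exact ⟨y, h hy, V, rfl⟩

instance : PiecewiseAWStar (F P) where
  exists_commCStar S hS := by
    refine ⟨genSet S, subset_genSet S, ?_⟩
    rw [genSet_eq_range hS]
    exact ⟨inferInstance, isCommCStarOn_range _⟩
  rp x := proj x.support
  sup X _ := proj (sSup ((fun x : Proj (F P) => (x : F P).support) '' X))
  exists_commAWStar := by
    refine ⟨genSet, fun S hS => ⟨subset_genSet S, ?_⟩, fun _ _ _ _ h => genSet_mono h⟩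
    rw [genSet_eq_range hS]
    exact ⟨inferInstance, isCommAWStarOn_range _⟩

theorem sup_eq (X : Set (Proj (F P))) (hX : PairwiseCommProj X) :
    PiecewiseAWStar.sup X hX = proj (sSup ((fun x : Proj (F P) => (x : F P).support) '' X)) := rfl

theorem isPiecewiseAWHom_map {f : P → Q} (hf : IsCOMLHom f) : IsPiecewiseAWHom (F.map hf) where
  toIsPiecewiseHom := isPiecewiseHom_map hf
  map_sup X hX := by
    simp only [sup_eq, projMap_map, hf.map_sSup, Set.image_image, support_projMap_map]

instance : CompleteOrthomodularLattice (Proj (F P)) :=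
  completeOrthomodularLatticeOfEquiv (projEquiv P).symm

theorem isCOMLHom_support : IsCOMLHom fun x : Proj (F P) => (x : F P).support where
  map_compl _ := support_proj _
  map_sSup _ := (support_proj _).trans sSup_image.symm

theorem isCOMLHom_proj : IsCOMLHom (proj : P → Proj (F P)) where
  map_compl p := by
    rw [← proj_support (proj p)ᶜ, isCOMLHom_support.map_compl, support_proj]
  map_sSup S := by
    rw [← proj_support (sSup (proj '' S)), isCOMLHom_support.map_sSup]
    simp only [Set.image_image, support_proj, Set.image_id']

theorem comm_proj_iff {p q : P} : Comm (proj p : F P) (proj q) ↔ LatComm p q := by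
  constructor
  · rintro ⟨C, f, g, hf, hg⟩
    rw [← support_proj p, ← support_proj q, hf, hg]
    exact C.latComm _ (support_mk_mem f) _ (support_mk_mem g)
  · intro h
    have hpq : ∀ r ∈ ({p, q} : Set P), ∀ s ∈ ({p, q} : Set P), LatComm r s := by
      rintro r (rfl | rfl) s (rfl | rfl)
      exacts [latComm_refl _, h, latComm_symm h, latComm_refl _]
    have hmem := subset_commutant_commutant ({p, q} : Set P)
    exact ⟨BoolSub.gen _ hpq, _, _, coe_proj ⟨p, hmem (.inl rfl)⟩, coe_proj ⟨q, hmem (.inr rfl)⟩⟩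

theorem coe_proj_compl (p : P) : ∃ h : Comm (1 : F P) ((-1 : ℂ) • (proj p : F P)),
    (proj pᶜ : F P) = PiecewiseOps.add _ _ h := by
  let q : (BoolSub.single p).carrier := ⟨p, BoolSub.mem_single p⟩
  rw [show (proj p : F P) = _ from coe_proj q, show (proj pᶜ : F P) = _ from coe_proj qᶜ,
    smul_mk, ← mk_one (BoolSub.single p)]
  refine ⟨comm_mk _ _, ?_⟩
  rw [add_mk, charFn_compl, neg_one_smul, sub_eq_add_neg]

instance : IsProjLattice (F P) where
  latComm_iff x y := by
    obtain ⟨p, rfl⟩ : ∃ p, proj p = x := ⟨_, proj_support x⟩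
    obtain ⟨q, rfl⟩ : ∃ q, proj q = y := ⟨_, proj_support y⟩
    refine .trans ⟨fun h => ?_, isCOMLHom_proj.latComm⟩ comm_proj_iff.symm
    simpa only [support_proj] using isCOMLHom_support.latComm h
  coe_compl x := by
    obtain ⟨p, rfl⟩ : ∃ p, proj p = x := ⟨_, proj_support x⟩
    rw [← isCOMLHom_proj.map_compl]
    exact coe_proj_compl p
  sSup_eq X hX := by
    rw [sup_eq, ← isCOMLHom_support.map_sSup, proj_support]

end PiecewiseAWStar

end F

/-! ### Commutative AW*-algebras inside a piecewise AW*-algebra -/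

section PairwiseComm

variable {A B : Type u} [PiecewiseOps A] [PiecewiseOps B] {S T : Set A}

theorem PairwiseComm.mono (hT : PairwiseComm T) (h : S ⊆ T) : PairwiseComm S :=
  fun a ha b hb => hT a (h ha) b (h hb)

theorem PairwiseComm.image {f : A → B} (hf : IsPiecewiseHom f) (hS : PairwiseComm S) :
    PairwiseComm (f '' S) := by
  rintro _ ⟨a, ha, rfl⟩ _ ⟨b, hb, rfl⟩
  exact hf.map_comm a b (hS a ha b hb)

theorem pairwiseComm_pair {a b : A} (h : Comm a b) : PairwiseComm {a, b} := by
  rintro _ (rfl | rfl) _ (rfl | rfl)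
  exacts [comm_refl _, h, comm_symm _ _ h, comm_refl _]

theorem pairwiseComm_singleton (a : A) : PairwiseComm {a} := by
  rintro _ rfl _ rfl
  exact comm_refl _

end PairwiseComm

/-- A pairwise commeasurable subset of `A` that is a commutative AW*-algebra under the operations
of `A`. -/
structure AWPart (A : Type u) [PiecewiseAWStar A] where
  carrier : Set A
  [commCStarAlgebra : CommCStarAlgebra carrier]
  isCommAWStarOn : IsCommAWStarOn PiecewiseAWStar.rp PiecewiseAWStar.sup carrier

attribute [instance] AWPart.commCStarAlgebra

namespace AWPart

variable {A B : Type u} [PiecewiseAWStar A] [PiecewiseAWStar B] {M N : AWPart A}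

theorem pairwiseComm (M : AWPart A) : PairwiseComm M.carrier := M.isCommAWStarOn.pairwiseComm

theorem isAWStar (M : AWPart A) : IsAWStar M.carrier := M.isCommAWStarOn.isAWStar

theorem comm (a b : M.carrier) : Comm (a : A) (b : A) := M.pairwiseComm _ a.2 _ b.2

theorem coe_one : ((1 : M.carrier) : A) = 1 := M.isCommAWStarOn.coe_one

theorem coe_star (a : M.carrier) : ((star a : M.carrier) : A) = star (a : A) :=
  M.isCommAWStarOn.coe_star a

theorem coe_smul (z : ℂ) (a : M.carrier) : ((z • a : M.carrier) : A) = z • (a : A) :=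
  M.isCommAWStarOn.coe_smul z a

theorem coe_mul (a b : M.carrier) : ((a * b : M.carrier) : A) = PiecewiseOps.mul _ _ (comm a b) :=
  M.isCommAWStarOn.coe_mul a b _

theorem coe_add (a b : M.carrier) : ((a + b : M.carrier) : A) = PiecewiseOps.add _ _ (comm a b) :=
  M.isCommAWStarOn.coe_add a b _

theorem isStarProjection_iff {a : M.carrier} : IsStarProjection a ↔ ∃ p : Proj A, (p : A) = a := by
  constructor
  · intro ha
    refine ⟨⟨a, ?_, ?_⟩, rfl⟩
    · rw [← coe_star, ha.isSelfAdjoint.star_eq]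
    · rw [← coe_mul a a, ha.isIdempotentElem.eq]
  · rcases a with ⟨_, ha⟩
    rintro ⟨p, rfl⟩
    exact ⟨Subtype.ext ((coe_mul _ _).trans p.2.2), Subtype.ext ((coe_star _).trans p.2.1)⟩

theorem isStarProjection_mk {p : Proj A} (hp : (p : A) ∈ M.carrier) :
    IsStarProjection (⟨p, hp⟩ : M.carrier) :=
  isStarProjection_iff.2 ⟨p, rfl⟩

/-- The star homomorphism between commutative AW*-algebras that a piecewise homomorphism restricts
to. -/
def map {f : A → B} (hf : IsPiecewiseHom f) {N : AWPart B} (h : Set.MapsTo f M.carrier N.carrier) :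
    M.carrier →⋆ₐ[ℂ] N.carrier :=
  let L : M.carrier →ₗ[ℂ] N.carrier :=
    { toFun := h.restrict
      map_add' a b := Subtype.ext <| by
        rw [coe_add]
        exact (congrArg f (coe_add a b)).trans (hf.map_add _ _ (comm a b))
      map_smul' z a := Subtype.ext <| by
        rw [coe_smul]
        exact (congrArg f (coe_smul z a)).trans (hf.map_smul z a) }
  { AlgHom.ofLinearMap L
      (Subtype.ext ((congrArg f coe_one).trans (hf.map_one.trans coe_one.symm)))
      (fun a b => Subtype.ext <| by
        rw [coe_mul]
        exact (congrArg f (coe_mul a b)).trans (hf.map_mul _ _ (comm a b))) with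
    map_star' a := Subtype.ext <| by
      rw [coe_star]
      exact (congrArg f (coe_star a)).trans (hf.map_star a) }

theorem coe_map {f : A → B} (hf : IsPiecewiseHom f) {N : AWPart B}
    (h : Set.MapsTo f M.carrier N.carrier) (a : M.carrier) : (map hf h a : B) = f a := rfl

/-- The inclusion of one commutative AW*-algebra into another. -/
def incl (h : M.carrier ⊆ N.carrier) : M.carrier →⋆ₐ[ℂ] N.carrier := map IsPiecewiseHom.id h

theorem incl_injective (h : M.carrier ⊆ N.carrier) : Function.Injective (incl h) :=
  Set.inclusion_injective h

/-- The commutative AW*-algebra assigned to a pairwise commeasurable set. -/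
def gen (S : Set A) (hS : PairwiseComm S) : AWPart A :=
  let h := (PiecewiseAWStar.exists_commAWStar.choose_spec.1 S hS).2
  letI := h.choose
  ⟨PiecewiseAWStar.exists_commAWStar.choose S, h.choose_spec⟩

variable {S S' : Set A}

theorem subset_gen (hS : PairwiseComm S) : S ⊆ (gen S hS).carrier :=
  (PiecewiseAWStar.exists_commAWStar.choose_spec.1 S hS).1

theorem gen_mono (hS : PairwiseComm S) (hS' : PairwiseComm S') (h : S ⊆ S') :
    (gen S hS).carrier ⊆ (gen S' hS').carrier :=
  PiecewiseAWStar.exists_commAWStar.choose_spec.2 S S' hS hS' h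

variable {R : Type u} [CommCStarAlgebra R]

theorem exists_starAlgHom_gen_coe_eq (hR : IsAWStar R) (φ : R →⋆ₐ[ℂ] M.carrier)
    (hS : PairwiseComm S) (hSM : S ⊆ M.carrier) (h : ∀ p, IsStarProjection p → (φ p : A) ∈ S) :
    ∃ χ : R →⋆ₐ[ℂ] (gen S hS).carrier, ∀ r, (χ r : A) = φ r := by
  obtain ⟨χ, hχ⟩ := hR.exists_comp_eq (incl_injective (gen_mono hS M.pairwiseComm hSM))
    (φ := (incl (subset_gen M.pairwiseComm)).comp φ)
    fun p hp => ⟨⟨_, subset_gen hS (h p hp)⟩, rfl⟩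
  exact ⟨χ, fun r => congrArg Subtype.val (DFunLike.congr_fun hχ r)⟩

theorem coe_eq_coe_of_isStarProjection (hR : IsAWStar R) {φ : R →⋆ₐ[ℂ] M.carrier}
    {ψ : R →⋆ₐ[ℂ] N.carrier} (h : ∀ p, IsStarProjection p → (φ p : A) = ψ p) (r : R) :
    (φ r : A) = ψ r := by
  -- Elements of `M` and `N` need not be commeasurable with each other, so the two homomorphisms are
  -- compared in the algebra assigned to the images of the projections.
  let S : Set A := {a | ∃ p, IsStarProjection p ∧ (φ p : A) = a}
  have hSM : S ⊆ M.carrier := by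
    rintro _ ⟨p, -, rfl⟩
    exact (φ p).2
  have hSN : S ⊆ N.carrier := by
    rintro _ ⟨p, hp, rfl⟩
    exact h p hp ▸ (ψ p).2
  have hS : PairwiseComm S := M.pairwiseComm.mono hSM
  obtain ⟨χ, hχ⟩ := exists_starAlgHom_gen_coe_eq hR φ hS hSM fun p hp => ⟨p, hp, rfl⟩
  obtain ⟨ξ, hξ⟩ := exists_starAlgHom_gen_coe_eq hR ψ hS hSN fun p hp => ⟨p, hp, h p hp⟩
  have hχξ : χ = ξ := hR.starAlgHom_ext fun p hp => Subtype.ext (by rw [hχ, hξ, h p hp])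
  rw [← hχ, ← hξ, hχξ]

theorem coe_eq_coe_of_charFn {P : Type u} [CompleteOrthomodularLattice P] {C : BoolSub P}
    {φ : Func C →⋆ₐ[ℂ] M.carrier} {ψ : Func C →⋆ₐ[ℂ] N.carrier}
    (h : ∀ p, (φ (charFn p) : A) = ψ (charFn p)) (f : Func C) :
    (φ f : A) = ψ f :=
  coe_eq_coe_of_isStarProjection (isAWStar_func C) (fun f hf => by
    obtain ⟨p, rfl⟩ := exists_charFn_eq hf.isIdempotentElem
    exact h p) f

end AWPart

theorem IsPiecewiseHom.ext_of_proj {A B : Type u} [PiecewiseAWStar A] [PiecewiseAWStar B]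
    {f g : A → B} (hf : IsPiecewiseHom f) (hg : IsPiecewiseHom g) (h : ∀ p : Proj A, f p = g p) :
    f = g := by
  ext a
  let M : AWPart A := .gen {a} (pairwiseComm_singleton a)
  have hfM : Set.MapsTo f M.carrier (AWPart.gen _ (M.pairwiseComm.image hf)).carrier :=
    fun b hb => AWPart.subset_gen _ ⟨b, hb, rfl⟩
  have hgM : Set.MapsTo g M.carrier (AWPart.gen _ (M.pairwiseComm.image hg)).carrier :=
    fun b hb => AWPart.subset_gen _ ⟨b, hb, rfl⟩
  refine AWPart.coe_eq_coe_of_isStarProjection M.isAWStar (φ := AWPart.map hf hfM)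
    (ψ := AWPart.map hg hgM) (fun p hp => ?_) ⟨a, AWPart.subset_gen _ rfl⟩
  obtain ⟨q, hq⟩ := AWPart.isStarProjection_iff.1 hp
  rw [AWPart.coe_map, AWPart.coe_map, ← hq, h q]

/-! ### Reconstruction of a piecewise AW*-algebra from its projections -/

section Reconstruction

variable {A : Type u} [PiecewiseAWStar A] [CompleteOrthomodularLattice (Proj A)]
  {C D : BoolSub (Proj A)} {M : AWPart A}

namespace AWPart

theorem injective_of_coe_charFn_eq {ψ : Func C →⋆ₐ[ℂ] M.carrier}
    (hψ : ∀ p : C.carrier, (ψ (charFn p) : A) = (p : Proj A)) : Function.Injective ψ := by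
  refine injective_of_clopenIndicator_ne_zero (ψ := (ψ : Func C →+* M.carrier)) fun K hK h => hK ?_
  obtain ⟨p, hp⟩ := exists_charFn_eq (isStarProjection_clopenIndicator K).isIdempotentElem
  obtain ⟨q, hq⟩ := exists_charFn_eq (C := C) IsIdempotentElem.zero
  obtain rfl : p = q := Subtype.ext <| Subtype.ext <| by
    rw [← hψ, ← hψ, hp, hq, map_zero]
    exact congrArg Subtype.val h
  exact clopenIndicator_injective (by rw [← hp, hq, clopenIndicator_bot])

variable [IsProjLattice A]

theorem coe_one_sub {p : Proj A} (hp : (p : A) ∈ M.carrier) :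
    ((1 - ⟨p, hp⟩ : M.carrier) : A) = (pᶜ : Proj A) := by
  obtain ⟨h, e⟩ := IsProjLattice.coe_compl p
  rw [e, sub_eq_add_neg, ← neg_one_smul ℂ, coe_add]
  congr 1
  · exact coe_one
  · exact coe_smul _ _

theorem exists_coe_eq_sSup {X : Set (Proj A)} (hX : ∀ p ∈ X, (p : A) ∈ M.carrier) :
    ∃ s : M.carrier, (s : A) = (sSup X : Proj A) ∧
      (∀ x : M.carrier, (∃ y ∈ X, (y : A) = x) → x * s = x) ∧
      ∀ q : M.carrier, IsStarProjection q →
        (∀ x : M.carrier, (∃ y ∈ X, (y : A) = x) → x * q = x) → s * q = s := by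
  have hX' : PairwiseCommProj X := fun p hp q hq => M.pairwiseComm _ (hX p hp) _ (hX q hq)
  rw [IsProjLattice.sSup_eq X hX']
  exact M.isCommAWStarOn.coe_sup X hX' hX

theorem coe_sup {p q : Proj A} (hp : (p : A) ∈ M.carrier) (hq : (q : A) ∈ M.carrier) :
    ((⟨p, hp⟩ + ⟨q, hq⟩ - ⟨p, hp⟩ * ⟨q, hq⟩ : M.carrier) : A) = (p ⊔ q : Proj A) := by
  obtain ⟨s, hs, hle, hmin⟩ := exists_coe_eq_sSup (M := M) (X := {p, q}) (by
    rintro x (rfl | rfl) <;> assumption)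
  have hpair : ∀ x : M.carrier, (∃ y ∈ ({p, q} : Set (Proj A)), (y : A) = x) →
      x = ⟨p, hp⟩ ∨ x = ⟨q, hq⟩ := by
    rintro x ⟨y, rfl | rfl, hy⟩
    exacts [.inl (Subtype.ext hy.symm), .inr (Subtype.ext hy.symm)]
  have hps := hle ⟨p, hp⟩ ⟨p, .inl rfl, rfl⟩
  have hqs := hle ⟨q, hq⟩ ⟨q, .inr rfl, rfl⟩
  have hp' := isStarProjection_mk hp
  have hq' := isStarProjection_mk hq
  rw [← sSup_pair, ← hs]
  generalize (⟨p, hp⟩ : M.carrier) = a at *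
  generalize (⟨q, hq⟩ : M.carrier) = b at *
  have haa := hp'.isIdempotentElem.eq
  have hbb := hq'.isIdempotentElem.eq
  have hsab := hmin (a + b - a * b) (hp'.add_sub_mul_of_commute (.all a b) hq') <| by
    intro x hx
    rcases hpair x hx with rfl | rfl
    · linear_combination (1 - b) * haa
    · linear_combination (1 - a) * hbb
  exact congrArg Subtype.val (by linear_combination hsab - (1 - b) * hps - hqs)

/-- The projections contained in a commutative AW*-algebra. -/
def projections (M : AWPart A) : BoolSub (Proj A) where
  carrier := {p | (p : A) ∈ M.carrier}
  latComm p hp q hq := (IsProjLattice.latComm_iff p q).2 (M.pairwiseComm _ hp _ hq)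
  compl_mem p hp := by
    rw [Set.mem_ofPred_eq, ← coe_one_sub hp]
    exact Subtype.coe_prop _
  sSup_mem _ hX := by
    obtain ⟨s, hs, -⟩ := exists_coe_eq_sSup hX
    rw [Set.mem_ofPred_eq, ← hs]
    exact s.2

theorem mem_projections {p : Proj A} : p ∈ M.projections.carrier ↔ (p : A) ∈ M.carrier := Iff.rfl

theorem exists_starAlgHom_coe_charFn_eq (h : C.carrier ⊆ M.projections.carrier) :
    ∃ ψ : Func C →⋆ₐ[ℂ] M.carrier, ∀ p : C.carrier, (ψ (charFn p) : A) = (p : Proj A) := by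
  obtain ⟨ψ, hψ⟩ := exists_starAlgHom_charFn (ι := fun p : C.carrier => (⟨_, h p.2⟩ : M.carrier))
    (fun p => isStarProjection_mk (h p.2)) (fun p => Subtype.ext (coe_one_sub (h p.2)).symm)
    (fun p q => Subtype.ext (coe_sup (h p.2) (h q.2)).symm)
  exact ⟨ψ, fun p => congrArg Subtype.val (hψ p)⟩

theorem surjective_of_coe_charFn_eq {ψ : Func M.projections →⋆ₐ[ℂ] M.carrier}
    (hψ : ∀ p : M.projections.carrier, (ψ (charFn p) : A) = (p : Proj A)) :
    Function.Surjective ψ := by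
  refine M.isAWStar.surjective_of_isStarProjection_mem_range (injective_of_coe_charFn_eq hψ)
    fun a ha => ?_
  obtain ⟨p, hp⟩ := isStarProjection_iff.1 ha
  have hpM : p ∈ M.projections.carrier := mem_projections.2 (hp ▸ a.2)
  exact ⟨charFn ⟨p, hpM⟩, Subtype.ext ((hψ _).trans hp)⟩

end AWPart

variable [IsProjLattice A]

namespace BoolSub

theorem pairwiseComm_image_val (C : BoolSub (Proj A)) :
    PairwiseComm (Subtype.val '' C.carrier : Set A) := by
  rintro _ ⟨p, hp, rfl⟩ _ ⟨q, hq, rfl⟩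
  exact (IsProjLattice.latComm_iff p q).1 (C.latComm p hp q hq)

/-- The commutative AW*-algebra assigned to the set of projections in `C`. -/
def awPart (C : BoolSub (Proj A)) : AWPart A :=
  .gen (Subtype.val '' C.carrier) C.pairwiseComm_image_val

theorem subset_projections_awPart (C : BoolSub (Proj A)) :
    C.carrier ⊆ C.awPart.projections.carrier :=
  fun p hp => AWPart.subset_gen C.pairwiseComm_image_val ⟨p, hp, rfl⟩

/-- The representation of the functions on the Stone space of `C` by elements of `A`, extending the
inclusion of the projections in `C`. -/
def rep (C : BoolSub (Proj A)) : Func C →⋆ₐ[ℂ] C.awPart.carrier :=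
  (AWPart.exists_starAlgHom_coe_charFn_eq C.subset_projections_awPart).choose

theorem coe_rep_charFn (p : C.carrier) : (C.rep (charFn p) : A) = (p : Proj A) :=
  (AWPart.exists_starAlgHom_coe_charFn_eq C.subset_projections_awPart).choose_spec p

theorem coe_rep_eq {ψ : Func C →⋆ₐ[ℂ] M.carrier}
    (hψ : ∀ p : C.carrier, (ψ (charFn p) : A) = (p : Proj A)) (f : Func C) :
    (C.rep f : A) = ψ f :=
  AWPart.coe_eq_coe_of_charFn (fun p => (coe_rep_charFn p).trans (hψ p).symm) f

theorem coe_rep_comp_stoneRes (h : C.carrier ⊆ D.carrier) (f : Func C) :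
    (D.rep (f.comp (stoneRes h)) : A) = C.rep f :=
  (coe_rep_eq (ψ := D.rep.comp (ContinuousMap.compStarAlgHom' ℂ ℂ (stoneRes h)))
    (fun p => coe_rep_charFn (Set.inclusion h p)) f).symm

end BoolSub

namespace F

/-- The canonical map to a piecewise AW*-algebra `A` from the piecewise algebra `F(Proj A)` built
from its projections. -/
def toAlgebra : F (Proj A) → A :=
  Quot.lift (fun x => (x.1.rep x.2 : A)) <| by
    rintro ⟨C, f⟩ ⟨D, g⟩ ⟨h, e⟩
    exact (BoolSub.coe_rep_comp_stoneRes h f).symm.trans (congrArg (D.rep · : _ → A) e.symm)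

theorem toAlgebra_mk (f : Func C) : toAlgebra (mk C f) = C.rep f := rfl

theorem toAlgebra_proj (p : Proj A) : toAlgebra (proj p : F (Proj A)) = p :=
  BoolSub.coe_rep_charFn (⟨p, BoolSub.mem_single p⟩ : (BoolSub.single p).carrier)

theorem isPiecewiseHom_toAlgebra : IsPiecewiseHom (toAlgebra : F (Proj A) → A) where
  map_comm := by
    rintro _ _ ⟨C, f, g, rfl, rfl⟩
    exact AWPart.comm (C.rep f) (C.rep g)
  map_mul := by
    rintro _ _ ⟨C, f, g, rfl, rfl⟩
    rw [mul_mk, toAlgebra_mk, map_mul]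
    exact AWPart.coe_mul _ _
  map_add := by
    rintro _ _ ⟨C, f, g, rfl, rfl⟩
    rw [add_mk, toAlgebra_mk, map_add]
    exact AWPart.coe_add _ _
  map_smul z x := by
    obtain ⟨C, f, rfl⟩ := exists_mk_eq x
    rw [smul_mk, toAlgebra_mk, map_smul]
    exact AWPart.coe_smul _ _
  map_star x := by
    obtain ⟨C, f, rfl⟩ := exists_mk_eq x
    rw [star_mk, toAlgebra_mk, map_star]
    exact AWPart.coe_star _
  map_one := by
    rw [← mk_one (BoolSub.trivial _), toAlgebra_mk, map_one]
    exact AWPart.coe_one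

theorem projMap_toAlgebra (x : Proj (F (Proj A))) :
    projMap isPiecewiseHom_toAlgebra x = (x : F (Proj A)).support :=
  Subtype.ext ((congrArg (toAlgebra ∘ Subtype.val) (proj_support x)).symm.trans (toAlgebra_proj _))

theorem isCOMLHom_projMap_toAlgebra :
    IsCOMLHom (projMap (isPiecewiseHom_toAlgebra (A := A))) := by
  rw [funext (projMap_toAlgebra (A := A))]
  exact isCOMLHom_support

theorem isPiecewiseAWHom_toAlgebra : IsPiecewiseAWHom (toAlgebra : F (Proj A) → A) where
  toIsPiecewiseHom := isPiecewiseHom_toAlgebra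
  map_sup X hX := by
    rw [← IsProjLattice.sSup_eq X hX, isCOMLHom_projMap_toAlgebra.map_sSup]
    exact IsProjLattice.sSup_eq _ _

theorem toAlgebra_mk_injective (C : BoolSub (Proj A)) :
    Function.Injective fun f => toAlgebra (mk C f) :=
  Subtype.val_injective.comp (AWPart.injective_of_coe_charFn_eq BoolSub.coe_rep_charFn)

theorem exists_toAlgebra_mk_eq {a : A} (ha : a ∈ M.carrier) :
    ∃ f : Func M.projections, toAlgebra (mk _ f) = a := by
  obtain ⟨ψ, hψ⟩ := AWPart.exists_starAlgHom_coe_charFn_eq (subset_refl M.projections.carrier)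
  obtain ⟨f, hf⟩ := AWPart.surjective_of_coe_charFn_eq hψ ⟨a, ha⟩
  exact ⟨f, (BoolSub.coe_rep_eq hψ f).trans (congrArg Subtype.val hf)⟩

theorem eq_mk_of_toAlgebra_eq {a : A}
    {k : Func (AWPart.gen {a} (pairwiseComm_singleton a)).projections}
    (hk : toAlgebra (mk _ k) = a) {x : F (Proj A)} (hx : toAlgebra x = a) : x = mk _ k := by
  obtain ⟨C, f, rfl⟩ := exists_mk_eq x
  let N : AWPart A := .gen C.awPart.carrier C.awPart.pairwiseComm
  have hCN : C.carrier ⊆ N.projections.carrier :=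
    fun p hp =>
    AWPart.subset_gen C.awPart.pairwiseComm (C.subset_projections_awPart hp)
  have haN : (AWPart.gen {a} (pairwiseComm_singleton a)).projections.carrier ⊆
      N.projections.carrier := fun p hp =>
    AWPart.gen_mono (pairwiseComm_singleton a) C.awPart.pairwiseComm
      (Set.singleton_subset_iff.2 (hx ▸ (C.rep f).2)) hp
  rw [← mk_comp_stoneRes hCN] at hx ⊢
  rw [← mk_comp_stoneRes haN] at hk ⊢
  exact congrArg _ (toAlgebra_mk_injective _ (hx.trans hk.symm))

theorem toAlgebra_injective : Function.Injective (toAlgebra : F (Proj A) → A) := by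
  intro x y hxy
  obtain ⟨k, hk⟩ := exists_toAlgebra_mk_eq
    (AWPart.subset_gen (pairwiseComm_singleton (toAlgebra x)) rfl)
  rw [eq_mk_of_toAlgebra_eq hk rfl, eq_mk_of_toAlgebra_eq hk hxy.symm]

theorem toAlgebra_surjective : Function.Surjective (toAlgebra : F (Proj A) → A) := fun a =>
  let ⟨k, hk⟩ := exists_toAlgebra_mk_eq (AWPart.subset_gen (pairwiseComm_singleton a) rfl)
  ⟨mk _ k, hk⟩

theorem comm_toAlgebra_iff {x y : F (Proj A)} :
    Comm (toAlgebra x) (toAlgebra y) ↔ Comm x y := by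
  refine ⟨fun h => ?_, isPiecewiseHom_toAlgebra.map_comm x y⟩
  have hxy := pairwiseComm_pair h
  obtain ⟨f, hf⟩ := exists_toAlgebra_mk_eq (AWPart.subset_gen hxy (.inl rfl))
  obtain ⟨g, hg⟩ := exists_toAlgebra_mk_eq (AWPart.subset_gen hxy (.inr rfl))
  have hfg := comm_mk f g
  rwa [toAlgebra_injective hf, toAlgebra_injective hg] at hfg

end F

end Reconstruction

/-! ### Isomorphisms of piecewise algebras -/

section Equiv

variable {A B : Type u}

theorem IsPiecewiseHom.coe_projMap [PiecewiseOps A] [PiecewiseOps B] {f : A → B}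
    (hf : IsPiecewiseHom f) (p : Proj A) : (projMap hf p : B) = f p := rfl

theorem IsPiecewiseHom.map_mem_symmetries [PiecewiseOps A] [PiecewiseOps B] {f : A → B}
    (hf : IsPiecewiseHom f) {s : A} (hs : s ∈ symmetries A) : f s ∈ symmetries B := by
  obtain ⟨p, h, rfl⟩ := hs
  refine ⟨projMap hf p, ?_, ?_⟩
  · simpa only [hf.coe_projMap, hf.map_one, hf.map_smul] using hf.map_comm _ _ h
  · simp only [hf.coe_projMap, hf.map_add, hf.map_one, hf.map_smul]

theorem IsPiecewiseHom.symm [PiecewiseOps A] [PiecewiseOps B] {e : A ≃ B}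
    (he : IsPiecewiseHom e) (hcomm : ∀ {a b}, Comm (e a) (e b) → Comm a b) :
    IsPiecewiseHom e.symm where
  map_comm a b h := hcomm (by simpa only [e.apply_symm_apply] using h)
  map_mul a b h := e.symm_apply_eq.2 (by simp only [he.map_mul, e.apply_symm_apply])
  map_add a b h := e.symm_apply_eq.2 (by simp only [he.map_add, e.apply_symm_apply])
  map_smul z a := e.symm_apply_eq.2 (by simp only [he.map_smul, e.apply_symm_apply])
  map_star a := e.symm_apply_eq.2 (by simp only [he.map_star, e.apply_symm_apply])
  map_one := e.symm_apply_eq.2 he.map_one.symm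

theorem IsPiecewiseAWHom.symm [PiecewiseAWStar A] [PiecewiseAWStar B] {e : A ≃ B}
    (he : IsPiecewiseAWHom e) (hcomm : ∀ {a b}, Comm (e a) (e b) → Comm a b) :
    IsPiecewiseAWHom e.symm where
  toIsPiecewiseHom := he.toIsPiecewiseHom.symm hcomm
  map_sup S hS := by
    have hinv : ∀ p, projMap he.toIsPiecewiseHom
        (projMap (he.toIsPiecewiseHom.symm hcomm) p) = p :=
      fun p => Subtype.ext (e.apply_symm_apply p)
    refine Subtype.ext (e.symm_apply_eq.2 ?_)
    rw [← he.toIsPiecewiseHom.coe_projMap, he.map_sup]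
    simp only [Set.image_image, hinv, Set.image_id']

end Equiv

section IsProjLattice

variable {A B : Type u} [PiecewiseAWStar A] [CompleteOrthomodularLattice (Proj A)]
  [IsProjLattice A] [PiecewiseAWStar B] [CompleteOrthomodularLattice (Proj B)] [IsProjLattice B]

theorem IsPiecewiseHom.projMap_compl {f : A → B} (hf : IsPiecewiseHom f) (p : Proj A) :
    projMap hf pᶜ = (projMap hf p)ᶜ := by
  obtain ⟨h, hp⟩ := IsProjLattice.coe_compl p
  obtain ⟨h', hp'⟩ := IsProjLattice.coe_compl (projMap hf p)
  refine Subtype.ext (Eq.trans ?_ hp'.symm)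
  simp only [hf.coe_projMap, hp, hf.map_add, hf.map_one, hf.map_smul]

theorem IsPiecewiseAWHom.monotone_projMap {f : A → B} (hf : IsPiecewiseAWHom f) :
    Monotone (projMap hf.toIsPiecewiseHom) := by
  intro p q hpq
  have hX : PairwiseCommProj {p, q} := by
    have h := (IsProjLattice.latComm_iff p q).1 (latComm_of_le hpq)
    rintro a (rfl | rfl) b (rfl | rfl)
    exacts [comm_refl _, h, comm_symm _ _ h, comm_refl _]
  have hsup := hf.map_sup _ hX
  rw [← IsProjLattice.sSup_eq, ← IsProjLattice.sSup_eq, Set.image_pair, sSup_pair, sSup_pair,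
    sup_eq_right.2 hpq] at hsup
  exact hsup ▸ le_sup_left

/-- Although only suprema of commeasurable projections are assumed to be preserved, an isomorphism
preserves all suprema, because it is an order isomorphism. -/
theorem IsPiecewiseAWHom.isCOMLHom_projMap {e : A ≃ B} (he : IsPiecewiseAWHom e)
    (he' : IsPiecewiseAWHom e.symm) : IsCOMLHom (projMap he.toIsPiecewiseHom) where
  map_compl := he.toIsPiecewiseHom.projMap_compl
  map_sSup S := by
    let o : Proj A ≃ Proj B :=
      { toFun := projMap he.toIsPiecewiseHom
        invFun := projMap he'.toIsPiecewiseHom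
        left_inv p := Subtype.ext (e.symm_apply_apply p)
        right_inv p := Subtype.ext (e.apply_symm_apply p) }
    rw [sSup_image]
    exact (o.toOrderIso he.monotone_projMap he'.monotone_projMap).map_sSup S

end IsProjLattice

/-! ### Transport of groups generated by symmetries -/

section Preimage

variable {A B : Type u} (e : A ≃ B) (G : Set B) [Group G]

instance : Group (e ⁻¹' G) :=
  (e.subtypeEquiv (p := (· ∈ e ⁻¹' G)) (q := (· ∈ G)) fun _ => Iff.rfl).group

/-- A bijection identifies a group with its preimage, which carries the transported structure. -/
def preimageMulEquiv : (e ⁻¹' G) ≃* G :=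
  (e.subtypeEquiv (p := (· ∈ e ⁻¹' G)) (q := (· ∈ G)) fun _ => Iff.rfl).mulEquiv

theorem coe_preimageMulEquiv (g : e ⁻¹' G) : (preimageMulEquiv e G g : B) = e g := rfl

variable [PiecewiseOps A] [PiecewiseOps B] {e G} (he : IsPiecewiseHom e)
  (he' : IsPiecewiseHom e.symm)

include he he'

theorem IsPiecewiseHom.comm_iff {a b : A} : Comm (e a) (e b) ↔ Comm a b :=
  ⟨fun h => by simpa only [e.symm_apply_apply] using he'.map_comm _ _ h, he.map_comm a b⟩

theorem IsPiecewiseHom.map_mem_symmetries_iff {a : A} :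
    e a ∈ symmetries B ↔ a ∈ symmetries A :=
  ⟨fun h => by simpa only [e.symm_apply_apply] using he'.map_mem_symmetries h,
    he.map_mem_symmetries⟩

theorem IsPiecewiseSubgroup.preimage (hG : IsPiecewiseSubgroup G) :
    IsPiecewiseSubgroup (e ⁻¹' G) where
  subset_unitaries a ha := by
    obtain ⟨h, h_one⟩ := hG.subset_unitaries ha
    simp only [← he.map_star] at h h_one
    refine ⟨(he.comm_iff he').1 h, e.injective ?_⟩
    rw [he.map_mul, he.map_one, h_one]
  comm_iff g h := by
    rw [← he.comm_iff he', ← coe_preimageMulEquiv, ← coe_preimageMulEquiv, hG.comm_iff,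
      ← map_mul, ← map_mul, (preimageMulEquiv e G).injective.eq_iff]
  coe_mul g h hc := e.injective (by
    rw [he.map_mul, ← coe_preimageMulEquiv, map_mul]
    exact hG.coe_mul _ _ _)
  coe_one := e.injective (by rw [he.map_one, ← coe_preimageMulEquiv, map_one, hG.coe_one])
  coe_inv g := e.injective (by
    rw [he.map_star, ← coe_preimageMulEquiv, map_inv, hG.coe_inv, coe_preimageMulEquiv])

theorem closure_symmetries_preimage
    (hG : Subgroup.closure {g : G | (g : B) ∈ symmetries B} = ⊤) :
    Subgroup.closure {g : e ⁻¹' G | (g : A) ∈ symmetries A} = ⊤ := by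
  let φ := preimageMulEquiv e G
  have h_image : φ '' {g : e ⁻¹' G | (g : A) ∈ symmetries A} =
      {g : G | (g : B) ∈ symmetries B} := by
    rw [← φ.surjective.image_preimage {g : G | (g : B) ∈ symmetries B}]
    exact congrArg (φ '' ·) (Set.ext fun g => (he.map_mem_symmetries_iff he').symm)
  refine Subgroup.map_injective (f := φ.toMonoidHom) φ.injective ?_
  rw [MonoidHom.map_closure, Subgroup.map_top_of_surjective _ φ.surjective, ← hG]
  exact congrArg Subgroup.closure h_image

end Preimage

/-! ### The functor from active lattices to extended piecewise AW*-algebras -/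

theorem F.map_congr {P Q : Type u} [CompleteOrthomodularLattice P] [CompleteOrthomodularLattice Q]
    {f g : P → Q} (hf : IsCOMLHom f) (hg : IsCOMLHom g) (h : f = g) : F.map hf = F.map hg := by
  subst h
  rfl

theorem F.isCOMLHom_projMap_map {P Q : Type u} [CompleteOrthomodularLattice P]
    [CompleteOrthomodularLattice Q] {f : P → Q} (hf : IsCOMLHom f) :
    IsCOMLHom (projMap (F.isPiecewiseHom_map hf)) := by
  have h : projMap (F.isPiecewiseHom_map hf) =
      F.proj ∘ f ∘ fun x : Proj (F P) => (x : F P).support :=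
    funext fun x => by
      conv_lhs => rw [← F.proj_support x]
      exact F.projMap_map hf _
  rw [h]
  exact F.isCOMLHom_proj.comp (hf.comp F.isCOMLHom_support)

namespace ActiveLattice

variable {Y Z : ActiveLattice.{u}}

/-- The action of `G` on `F(P)` induced by its action on `P`. -/
def funcAct (Y : ActiveLattice.{u}) : Y.G →* Equiv.Perm (F Y.P) :=
  MonoidHom.toHomPerm
    { toFun g := F.map (Y.act_isHom g)
      map_one' := (F.map_congr _ .id (congrArg _ (map_one Y.act))).trans (funext F.map_id)
      map_mul' g h := (F.map_congr (Y.act_isHom (g * h)) ((Y.act_isHom g).comp (Y.act_isHom h))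
        (congrArg _ (map_mul Y.act g h))).trans (funext (F.map_comp _ _)) }

theorem funcAct_apply (g : Y.G) (x : F Y.P) : Y.funcAct g x = F.map (Y.act_isHom g) x := rfl

/-- The extended piecewise AW*-algebra `(F(P), Proj(F(P)), G, F(·))` of an active lattice. -/
abbrev toExt (Y : ActiveLattice.{u}) : ExtPiecewiseAWStar.{u} where
  A := F Y.P
  latComm_iff := IsProjLattice.latComm_iff
  coe_compl := IsProjLattice.coe_compl
  sSup_eq := IsProjLattice.sSup_eq
  G := Y.G
  isPiecewiseSubgroup := Y.isPiecewiseSubgroup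
  symmetries_subset := Y.symmetries_subset
  closure_symmetries := Y.closure_symmetries
  act := Y.funcAct
  act_isHom g := F.isPiecewiseAWHom_map (Y.act_isHom g)
  act_conj := Y.act_conj

/-- The morphism of extended piecewise AW*-algebras induced by a morphism of active lattices. -/
def Hom.toExt (f : ActiveLattice.Hom Y Z) : ExtPiecewiseAWStar.Hom Y.toExt Z.toExt where
  toFun := F.map f.isHom
  isHom := F.isPiecewiseAWHom_map f.isHom
  isCOMLHom := F.isCOMLHom_projMap_map f.isHom
  group_equivariant := by
    obtain ⟨φ, hφ, hact⟩ := f.group_equivariant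
    refine ⟨φ, hφ, fun u x => ?_⟩
    rw [funcAct_apply, funcAct_apply, ← F.map_comp, ← F.map_comp]
    exact congrFun (F.map_congr _ _ (funext (hact u))) x

/-- The functor `P ↦ F(P)` from active lattices to extended piecewise AW*-algebras. -/
def extFunctor : ActiveLattice.{u} ⥤ ExtPiecewiseAWStar.{u} where
  obj := toExt
  map := Hom.toExt
  map_id _ := ExtPiecewiseAWStar.Hom.ext (funext F.map_id)
  map_comp f g := ExtPiecewiseAWStar.Hom.ext (funext (F.map_comp g.isHom f.isHom))

instance : extFunctor.{u}.Faithful where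
  map_injective {_ _ f g} h := by
    have hmap : F.map f.isHom = F.map g.isHom := congrArg ExtPiecewiseAWStar.Hom.toFun h
    refine ActiveLattice.Hom.ext (funext fun p => F.coe_proj_inj.1 ?_)
    rw [← F.map_proj f.isHom, ← F.map_proj g.isHom, hmap]

/-- The restriction of a morphism `F(P) → F(Q)` to projections, read as a map `P → Q`. -/
def supportMap (h : ExtPiecewiseAWStar.Hom Y.toExt Z.toExt) (p : Y.P) : Z.P :=
  (h.toFun (F.proj p)).support

theorem isCOMLHom_supportMap (h : ExtPiecewiseAWStar.Hom Y.toExt Z.toExt) :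
    IsCOMLHom (supportMap h) :=
  F.isCOMLHom_support.comp (h.isCOMLHom.comp F.isCOMLHom_proj)

theorem proj_supportMap (h : ExtPiecewiseAWStar.Hom Y.toExt Z.toExt) (p : Y.P) :
    (F.proj (supportMap h p) : F Z.P) = h.toFun (F.proj p) :=
  congrArg Subtype.val (F.proj_support (projMap h.isHom.toIsPiecewiseHom (F.proj p)))

theorem map_supportMap (h : ExtPiecewiseAWStar.Hom Y.toExt Z.toExt) :
    F.map (isCOMLHom_supportMap h) = h.toFun := by
  refine (F.isPiecewiseHom_map _).ext_of_proj h.isHom.toIsPiecewiseHom fun x => ?_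
  rw [← F.proj_support x, F.map_proj, proj_supportMap]

instance : extFunctor.{u}.Full where
  map_surjective {Y Z} (h : ExtPiecewiseAWStar.Hom Y.toExt Z.toExt) := by
    obtain ⟨φ, hφ, hact⟩ := h.group_equivariant
    refine ⟨⟨supportMap h, isCOMLHom_supportMap h, φ, fun g => ?_, fun u p => ?_⟩,
      ExtPiecewiseAWStar.Hom.ext (map_supportMap h)⟩
    · rw [hφ, map_supportMap]
    · refine F.coe_proj_inj.1 ?_
      rw [proj_supportMap, ← F.map_proj (Y.act_isHom u), ← F.map_proj (Z.act_isHom _),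
        proj_supportMap]
      exact hact u (F.proj p)

end ActiveLattice

/-! ### The active lattice of an extended piecewise AW*-algebra -/

namespace ExtPiecewiseAWStar

variable {X Y : ExtPiecewiseAWStar.{u}}

instance : IsProjLattice X.A := ⟨X.latComm_iff, X.coe_compl, X.sSup_eq⟩

/-- A structure-preserving bijection of extended piecewise AW*-algebras is an isomorphism. -/
def isoOfEquiv (e : X.A ≃ Y.A) (he : IsPiecewiseAWHom e) (he' : IsPiecewiseAWHom e.symm)
    (φ : X.G ≃* Y.G) (hφ : ∀ g, (φ g : Y.A) = e g)
    (hact : ∀ u a, e (X.act u a) = Y.act (φ u) (e a)) : X ≅ Y where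
  hom := ⟨e, he, he.isCOMLHom_projMap he', φ.toMonoidHom, hφ, hact⟩
  inv := ⟨e.symm, he', he'.isCOMLHom_projMap he, φ.symm.toMonoidHom,
    fun g => e.eq_symm_apply.2 ((hφ _).symm.trans (congrArg _ (φ.apply_symm_apply g))),
    fun u b => e.symm_apply_eq.2 (by
      rw [hact, e.apply_symm_apply]
      exact congrArg (Y.act · b) (φ.apply_symm_apply u).symm)⟩
  hom_inv_id := Hom.ext (funext e.symm_apply_apply)
  inv_hom_id := Hom.ext (funext e.apply_symm_apply)

theorem isPiecewiseAWHom_act_symm (g : X.G) : IsPiecewiseAWHom (X.act g).symm := by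
  rw [← Equiv.Perm.inv_def, ← map_inv]
  exact X.act_isHom g⁻¹

theorem isCOMLHom_projMap_act (g : X.G) : IsCOMLHom (projMap (X.act_isHom g).toIsPiecewiseHom) :=
  (X.act_isHom g).isCOMLHom_projMap (isPiecewiseAWHom_act_symm g)

/-- The action of `G` on `Proj(A)` obtained by restricting its action on `A`. -/
def projAct (X : ExtPiecewiseAWStar.{u}) : X.G →* Equiv.Perm (Proj X.A) :=
  MonoidHom.toHomPerm
    { toFun g := projMap (X.act_isHom g).toIsPiecewiseHom
      map_one' := funext fun p => Subtype.ext (Equiv.congr_fun (map_one X.act) (p : X.A))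
      map_mul' g h := funext fun p => Subtype.ext (Equiv.congr_fun (map_mul X.act g h) (p : X.A)) }

/-- The reconstruction of `A` from its lattice of projections. -/
def algebraEquiv (X : ExtPiecewiseAWStar.{u}) : F (Proj X.A) ≃ X.A :=
  .ofBijective F.toAlgebra ⟨F.toAlgebra_injective, F.toAlgebra_surjective⟩

theorem isPiecewiseAWHom_algebraEquiv (X : ExtPiecewiseAWStar.{u}) :
    IsPiecewiseAWHom X.algebraEquiv :=
  F.isPiecewiseAWHom_toAlgebra

theorem isPiecewiseAWHom_algebraEquiv_symm (X : ExtPiecewiseAWStar.{u}) :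
    IsPiecewiseAWHom X.algebraEquiv.symm :=
  X.isPiecewiseAWHom_algebraEquiv.symm F.comm_toAlgebra_iff.1

theorem algebraEquiv_map_act (g : X.G) (x : F (Proj X.A)) :
    X.algebraEquiv (F.map (isCOMLHom_projMap_act g) x) = X.act g (X.algebraEquiv x) := by
  have hX := X.isPiecewiseAWHom_algebraEquiv.toIsPiecewiseHom
  refine congrFun ((hX.comp (F.isPiecewiseHom_map _)).ext_of_proj
    ((X.act_isHom g).toIsPiecewiseHom.comp hX) fun y => ?_) x
  rw [← F.proj_support y, Function.comp_apply, Function.comp_apply, F.map_proj]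
  exact (F.toAlgebra_proj _).trans (congrArg (X.act g) (F.toAlgebra_proj _).symm)

/-- The active lattice `(Proj(A), G, ·)` of an extended piecewise AW*-algebra, with `G` transported
along `F(Proj(A)) ≃ A`. -/
abbrev toActiveLattice (X : ExtPiecewiseAWStar.{u}) : ActiveLattice.{u} where
  P := Proj X.A
  G := X.algebraEquiv ⁻¹' X.G
  isPiecewiseSubgroup := X.isPiecewiseSubgroup.preimage
    X.isPiecewiseAWHom_algebraEquiv.toIsPiecewiseHom
    X.isPiecewiseAWHom_algebraEquiv_symm.toIsPiecewiseHom
  symmetries_subset _ hx := X.symmetries_subset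
    (X.isPiecewiseAWHom_algebraEquiv.toIsPiecewiseHom.map_mem_symmetries hx)
  closure_symmetries := closure_symmetries_preimage
    X.isPiecewiseAWHom_algebraEquiv.toIsPiecewiseHom
    X.isPiecewiseAWHom_algebraEquiv_symm.toIsPiecewiseHom X.closure_symmetries
  act := X.projAct.comp (preimageMulEquiv X.algebraEquiv X.G).toMonoidHom
  act_isHom g := isCOMLHom_projMap_act (preimageMulEquiv X.algebraEquiv X.G g)
  act_conj g h := X.algebraEquiv.injective (by
    refine (algebraEquiv_map_act (preimageMulEquiv X.algebraEquiv X.G g) h).trans ?_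
    rw [← coe_preimageMulEquiv, ← coe_preimageMulEquiv, X.act_conj, map_mul, map_mul, map_inv])

/-- An extended piecewise AW*-algebra is isomorphic to that of its active lattice. -/
def isoToExt (X : ExtPiecewiseAWStar.{u}) : X.toActiveLattice.toExt ≅ X :=
  isoOfEquiv X.algebraEquiv X.isPiecewiseAWHom_algebraEquiv X.isPiecewiseAWHom_algebraEquiv_symm
    (preimageMulEquiv X.algebraEquiv X.G) (coe_preimageMulEquiv _ _)
    fun u => algebraEquiv_map_act (preimageMulEquiv X.algebraEquiv X.G u)

end ExtPiecewiseAWStar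

instance : ActiveLattice.extFunctor.{u}.EssSurj where
  mem_essImage X := ⟨X.toActiveLattice, ⟨X.isoToExt⟩⟩

instance : ActiveLattice.extFunctor.{u}.IsEquivalence where

end

end ActiveLattices

theorem mainTheorem8 :
    Nonempty (ActiveLattices.ExtPiecewiseAWStar.{u} ≌ ActiveLattices.ActiveLattice.{u}) :=
  ⟨ActiveLattices.ActiveLattice.extFunctor.asEquivalence.symm⟩
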